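/- Let $K\cong\mathbb F_q$ be a finite field, let $V$ be a $K$-vector space of finite dimension $n>1$, and let $G\le GL(V)$ with $\gcd(|G|,|V|)=1$. Let $r\ge 3$ be a prime and let $Z\le N\le G$ be normal subgroups of $G$ such that $Z=Z(G)$ is the group of all scalar transformations of $V$, $N/Z$ is an elementary abelian $r$-group, and $V$ is an absolutely irreducible $KN$-module. By a *monomial frame* of $N$ we mean a decomposition $N=D\rtimes S$, $D=Z\times D_1$, together with a basis $(u_w)_{w\in W}$ of $V$ indexed by a vector space $W=\mathbb F_r^k$ such that the elements of $S$ are exactly the translations $u_w\mapsto u_{a+w}$ ($a\in W$), all elements of $D$ are diagonal in this basis, and $D_1$ fixes the basis vector $u_0$. (So $n=r^k=|W|$, and $S\cong C_r^k$ permutes the basis regularly.) (a) If no normal subgroup of $G$ lies strictly between $Z$ and $N$, then $N$ has a monomial frame. (b) Let a monomial frame of $N$ be given, let $e_1,\dots,e_k$ be a basis of $W$, let $\alpha$ be a generator of $K^\times$, and put $x=u_0$. Let $H$ be the group of all permutations $\sigma$ of $W$ for which there is $g\in G$ with $g u_0=u_0$ and $g u_w\in K^\times u_{\sigma(w)}$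 for all $w\in W$. Call a partition of $W$ (empty parts allowed) $H$-regular if only the identity of $H$ stabilises every part setwise. Define $y$ as follows. * If $k=1$ and $|W|\ne 3$: $y=\sum_{w\ne e_1}u_w$. * If $k\ge 2$ and $|W|\neq 9$: $y=\alpha u_{e_1}+\sum_{w\in\Omega_3}u_w$, where $W=\{e_1\}\cup\Omega_2\cup\Omega_3$ is any $H$-regular partition with $|\Omega_2|+2<\frac14|W|$. The sets $\Omega_2=\{e_2,\dots,e_k,\,e_1+e_2,\,e_2+e_3,\dots,e_{k-1}+e_k\}$, $\Omega_3=W\setminus(\{e_1\}\cup\Omega_2)$ form such a partition. * If $k=2$ and $|W|=9$: $y=\alpha u_{e_1}+0\cdot u_{e_2}+\sum_{w\notin\{e_1,e_2\}}u_w$. * If $|W|=3$: $y=\alpha u_{w_2}+u_{w_3}$, where $w_2,w_3$ are the two nonzero elements of $W$, in either order. Then $C_G(x)\cap C_G(y)=1$. -/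

import Mathlib

open scoped TensorProduct

noncomputable section

namespace SymplecticType

/-- The group of all (nonzero) scalar transformations of `V`. -/
def scalarGroup (K V : Type*) [Field K] [AddCommGroup V] [Module K V] :
    Subgroup (V ≃ₗ[K] V) where
  carrier := {g | ∃ c : Kˣ, ∀ v : V, g v = (c : K) • v}
  one_mem' := ⟨1, fun v => by simp⟩
  mul_mem' := by
    rintro a b ⟨c, hc⟩ ⟨d, hd⟩
    exact ⟨c * d, fun v => by simp [hc, hd, mul_smul]⟩
  inv_mem' := by
    rintro a ⟨c, hc⟩
    refine ⟨c⁻¹, fun v => ?_⟩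
    apply a.injective
    rw [← LinearEquiv.mul_apply, mul_inv_cancel, LinearEquiv.coe_one, id, hc, smul_smul]
    simp

section
variable {K V : Type*} [Field K] [AddCommGroup V] [Module K V]

/-- `V` is an absolutely irreducible `KN`-module: it is nonzero, and after extension of scalars to
an algebraic closure of `K` the only `N`-invariant subspaces are zero and the whole space. -/
def IsAbsolutelyIrreducible (N : Subgroup (V ≃ₗ[K] V)) : Prop :=
  Nontrivial V ∧
    ∀ U : Submodule (AlgebraicClosure K) (AlgebraicClosure K ⊗[K] V),
      (∀ g ∈ N, ∀ x ∈ U,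
        LinearMap.baseChange (AlgebraicClosure K) (g : V →ₗ[K] V) x ∈ U) → U = ⊥ ∨ U = ⊤

/-- `G` is a linear group of symplectic type, witnessed by the normal subgroups `Z ≤ N` of `G` and
the prime `r`: `Z` is the centre of `G`, the quotient `N / Z` is an elementary abelian `r`-group,
and `V` is an absolutely irreducible `KN`-module. -/
structure IsOfSymplecticType (G Z N : Subgroup (V ≃ₗ[K] V)) (r : ℕ) : Prop where
  prime : r.Prime
  center : Z = (Subgroup.center G).map G.subtype
  Z_le_N : Z ≤ N
  N_le_G : N ≤ G
  normal : (N.subgroupOf G).Normal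
  comm_mem : ∀ x ∈ N, ∀ y ∈ N, x * y * x⁻¹ * y⁻¹ ∈ Z
  pow_mem : ∀ x ∈ N, x ^ r ∈ Z
  absIrred : IsAbsolutelyIrreducible N

/-- No normal subgroup of `G` lies strictly between `Z` and `N`. -/
def IsChief (G Z N : Subgroup (V ≃ₗ[K] V)) : Prop :=
  ∀ M : Subgroup (V ≃ₗ[K] V), Z ≤ M → M ≤ N → (M.subgroupOf G).Normal → M = Z ∨ M = N

/-- The decomposition `N = D ⋊ S`, `D = Z × D₁`, with an adapted basis of `V`. The basis is
labelled by the elements of the `r`-elementary abelian group `W` in such a way that the basis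
vector `u₁` gets the label `0` and the elements of `S` are exactly the translations
`u_w ↦ u_{a + w}`; thus `S ≅ W` permutes the basis regularly, and the group structure of `W` is the
one that the regular action of `S` induces on the basis when `u₁` is identified with `1 ∈ S`.
The elements of `D` are diagonal, and `D₁` fixes `u₁`. (When `N` is as in
`IsOfSymplecticType`, it follows that `D₁ ≅ S`, and that the lines spanned by the basis vectors
are pairwise non-isomorphic `D₁`-modules which realise all the irreducible ones.) -/
structure IsMonomialFrame {W : Type*} [AddCommGroup W]
    (Z N D D₁ S : Subgroup (V ≃ₗ[K] V)) (u : Module.Basis W K V) : Prop where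
  sup_eq : D ⊔ S = N
  inf_eq : D ⊓ S = ⊥
  normal : (D.subgroupOf N).Normal
  D_eq : Z ⊔ D₁ = D
  Z_inf : Z ⊓ D₁ = ⊥
  mem_S : ∀ s : V ≃ₗ[K] V, s ∈ S ↔ ∃ a : W, ∀ w : W, s (u w) = u (a + w)
  diagonal : ∀ d ∈ D, ∀ w : W, ∃ c : K, d (u w) = c • u w
  fixes : ∀ d ∈ D₁, d (u 0) = u 0

/-- The group `π(C_G(u₁))` of the permutation parts of those elements of `G` that fix `u₁ = u 0`
(and are monomial with respect to the basis `u`), as permutations of the labels of the basis: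
`g = δ(g) π(g)` with `δ(g)` diagonal and `π(g) = σ` means that `g u_w` is a multiple of
`u_{σ w}` for all `w`. -/
def permPart {W : Type*} [Zero W] (G : Subgroup (V ≃ₗ[K] V)) (u : Module.Basis W K V) :
    Subgroup (Equiv.Perm W) where
  carrier := {σ | ∃ g ∈ G, g (u 0) = u 0 ∧ ∀ w, ∃ c : Kˣ, g (u w) = (c : K) • u (σ w)}
  one_mem' := ⟨1, G.one_mem, by simp, fun w => ⟨1, by simp⟩⟩
  mul_mem' := by
    rintro σ τ ⟨g, hg, hg0, hgw⟩ ⟨h, hh, hh0, hhw⟩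
    refine ⟨g * h, G.mul_mem hg hh, by simp [hg0, hh0], fun w => ?_⟩
    obtain ⟨c, hc⟩ := hhw w
    obtain ⟨d, hd⟩ := hgw (τ w)
    exact ⟨c * d, by simp [hc, hd, mul_smul]⟩
  inv_mem' := by
    rintro σ ⟨g, hg, hg0, hgw⟩
    refine ⟨g⁻¹, G.inv_mem hg, ?_, fun w => ?_⟩
    · apply g.injective
      rw [← LinearEquiv.mul_apply, mul_inv_cancel, LinearEquiv.coe_one, id, hg0]
    · obtain ⟨c, hc⟩ := hgw (σ⁻¹ w)
      refine ⟨c⁻¹, ?_⟩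
      apply g.injective
      rw [← LinearEquiv.mul_apply, mul_inv_cancel, LinearEquiv.coe_one, id, map_smul, hc,
        smul_smul]
      simp

end

/-- The sets `P i` (possibly empty) form an `H`-regular partition of `Ω`: they are pairwise
disjoint, they cover `Ω`, and only the identity of the permutation group `H` stabilises every
`P i` setwise. -/
structure IsRegularPartition {Ω ι : Type*} (H : Subgroup (Equiv.Perm Ω)) (P : ι → Finset Ω) :
    Prop where
  disjoint : Pairwise fun i j => Disjoint (P i) (P j)
  cover : ∀ w : Ω, ∃ i, w ∈ P i
  regular : ∀ σ ∈ H, (∀ i, σ '' (P i : Set Ω) = (P i : Set Ω)) → σ = 1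

/-- The set `{e₂, …, e_k, e₁ + e₂, e₂ + e₃, …, e_{k-1} + e_k}` (the basis is numbered from `0` by
`Fin k`). -/
def stdOmega₂ {r k : ℕ} [NeZero r]
    (e : Module.Basis (Fin k) (ZMod r) (Fin k → ZMod r)) : Finset (Fin k → ZMod r) :=
  Finset.univ.filter fun w =>
    (∃ i : Fin k, 0 < i.val ∧ w = e i) ∨
      (∃ i j : Fin k, i.val + 1 = j.val ∧ w = e i + e j)

/-- `C_G(x) ∩ C_G(y) = 1`. -/
def IsBasePair {K V : Type*} [Field K] [AddCommGroup V] [Module K V]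
    (G : Subgroup (V ≃ₗ[K] V)) (x y : V) : Prop :=
  MulAction.stabilizer G x ⊓ MulAction.stabilizer G y = ⊥

end SymplecticType

end

/-! For the base pairs, an element `g` of `G` fixing `u 0` is monomial with very rigid data: `g u_w
= c(w) u_{σ w}` with `σ` additive and `c : W → Kˣ` quadratic (`exists_quadratic`). Indeed `D` is the
set of elements of `N` that keep the line of `u 0`, so `g` normalises it and permutes its weight
lines. These lines are pairwise distinct by Schur's lemma. Conjugating the translations by `g` back
into `N = DS` makes `σ` additive and `c` quadratic. If `g` also fixes `y`, then the coordinates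
satisfy `y_{σ w} = c(w) y_w`. The choice of `y` makes `c` equal to `1` except on a small set, and a
quadratic function that is `1` outside fewer than a quarter of the points is constantly `1`
(`IsQuadratic.eq_one_of_small_support`). What remains is to force `σ = 1`, from the zero coordinate
of `y` or from the regular partition; the coefficient `α ≠ 1` marks `e₁`. For `|W| = 9` and `|W| =
3` the quarter bound is too weak. If `σ` moves the marked label there, `α` is a value of `c`, so `α
^ r = 1`; then `|V|` is even, `|G|` is odd by coprimality, and `σ` cannot be an involution. For the
existence of a frame, the commutator makes `N / Z` a nondegenerate symplectic space, and a maximal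
abelian `D` has an abelian complement modulo `Z`. Chiefness makes every `r`-th power in `N` an
`r`-th power of a scalar, so `D` and its complement have eigenvectors. Stabilising these splits off
`Z`, and the orbit under `S` of an eigenvector of `D` is the basis. -/

open scoped commutatorElement

noncomputable section

namespace SymplecticType

/-! ### Quadratic functions on an abelian group -/

section Quadratic

variable {W A : Type*} [AddCommGroup W] [CommGroup A]

/-- A function to a multiplicative abelian group with value `1` at `0` and trivial third
differences. -/
structure IsQuadratic (c : W → A) : Prop where
  map_zero : c 0 = 1
  cube : ∀ a b d, c (a + b + d) * c a * c b * c d = c (a + b) * c (b + d) * c (a + d)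

/-- The polarisation of a function to a multiplicative abelian group. -/
def polar (c : W → A) (a b : W) : A := c (a + b) / (c a * c b)

lemma polar_comm (c : W → A) (a b : W) : polar c a b = polar c b a := by
  unfold polar; rw [add_comm, mul_comm (c a)]

lemma map_add_eq_polar (c : W → A) (a b : W) : c (a + b) = c a * c b * polar c a b := by
  unfold polar; rw [mul_div_cancel]

/-- A homomorphism that is trivial outside fewer than half of the elements is trivial. -/
lemma hom_trivial_of_small_support [Fintype W] [DecidableEq W] (f : Multiplicative W →* A)
    (T : Finset W)
    (hT : 2 * T.card < Fintype.card W) (h : ∀ w ∉ T, f (.ofAdd w) = 1) (w : W) :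
    f (.ofAdd w) = 1 := by
  -- `T` and `T - w` cannot cover the group, so some `x` has both `x` and `x + w` outside `T`; then
  -- `f w = f (x + w) / f x = 1`.
  obtain ⟨x, hx⟩ : ∃ x, x ∉ T ∪ T.image (fun t => t - w) := by
    by_contra! hall
    have := Finset.card_le_card (fun x _ => hall x : Finset.univ ⊆ _)
    have h1 := Finset.card_union_le T (T.image (fun t => t - w))
    have h2 := Finset.card_image_le (s := T) (f := fun t => t - w)
    rw [Finset.card_univ] at this
    omega
  simp only [Finset.mem_union, Finset.mem_image, not_or, not_exists, not_and] at hx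
  have hxw : x + w ∉ T := fun hm => hx.2 _ hm (by abel)
  have := h _ hxw
  rwa [ofAdd_add, map_mul, h _ hx.1, one_mul] at this

variable {c : W → A}

/-- The polarisation of a quadratic function as a homomorphism in the second variable. -/
def IsQuadratic.polarHom (hc : IsQuadratic c) (a : W) : Multiplicative W →* A :=
  MonoidHom.mk' (fun b => polar c a b.toAdd) (by
    intro b d
    have h := hc.cube a b.toAdd d.toAdd
    have h2 := map_add_eq_polar c b.toAdd d.toAdd
    simp only [toAdd_mul, polar]
    rw [div_mul_div_comm, div_eq_div_iff_mul_eq_mul, ← add_assoc]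
    calc _ = (c (a + b.toAdd + d.toAdd) * c a * c b.toAdd * c d.toAdd) * c a := by
            simp only [mul_comm, mul_left_comm]
      _ = _ := by rw [h]; simp only [mul_comm, mul_left_comm])

lemma IsQuadratic.polar_nsmul (hc : IsQuadratic c) (a b : W) (j : ℕ) :
    polar c a (j • b) = polar c a b ^ j :=
  map_pow (hc.polarHom a) (Multiplicative.ofAdd b) j

lemma IsQuadratic.map_nsmul (hc : IsQuadratic c) (a : W) (j : ℕ) :
    c (j • a) = c a ^ j * polar c a a ^ j.choose 2 := by
  induction j with
  | zero => simp [hc.map_zero]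
  | succ j ih =>
    rw [succ_nsmul', map_add_eq_polar c, ih, hc.polar_nsmul, Nat.choose_succ_succ' j 1,
      Nat.choose_one_right, pow_succ, pow_add]
    simp only [mul_comm, mul_left_comm, mul_assoc, Nat.reduceAdd]

/-- Expand `1 = c (r • w)` by `map_nsmul`. For `r ≥ 3` the prime `r` divides `r.choose 2`, and
`polar c w w ^ r = polar c w 0 = 1`, so only `c w ^ r` survives. -/
lemma IsQuadratic.pow_eq_one (hc : IsQuadratic c) {r : ℕ} (hr : r.Prime) (hr3 : 3 ≤ r)
    (hW : ∀ w : W, r • w = 0)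
    (w : W) : c w ^ r = 1 := by
  have h := hc.map_nsmul w r
  have hp : polar c w w ^ r = 1 := by
    rw [← hc.polar_nsmul, hW, polar, add_zero, hc.map_zero, mul_one, div_self']
  obtain ⟨m, hm⟩ : r ∣ r.choose 2 := hr.dvd_choose_self (by norm_num) hr3
  rw [hW, hc.map_zero, hm, pow_mul, hp, one_pow, mul_one] at h
  exact h.symm

/-- The bound of one half for homomorphisms is used three times. For `a ∉ T`, `polar c a` is trivial
off `T ∪ (T - a)`, which is less than half of `W`, hence trivial. By symmetry each `polar c b` is
then trivial off `T`, hence trivial, so `c` is itself a homomorphism that is trivial off `T`. -/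
lemma IsQuadratic.eq_one_of_small_support (hc : IsQuadratic c) [Fintype W] [DecidableEq W]
    (T : Finset W) (hT : 4 * T.card < Fintype.card W) (h : ∀ w ∉ T, c w = 1) (w : W) : c w = 1 := by
  have key : ∀ a ∉ T, ∀ b, polar c a b = 1 := by
    intro a ha b
    refine hom_trivial_of_small_support (hc.polarHom a) (T ∪ T.image (fun t => t - a)) ?_ ?_ b
    · have h1 := Finset.card_union_le T (T.image (fun t => t - a))
      have h2 := Finset.card_image_le (s := T) (f := fun t => t - a)
      omega
    · intro b hb
      simp only [Finset.mem_union, Finset.mem_image, not_or, not_exists, not_and] at hb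
      have hab : a + b ∉ T := fun hm => hb.2 _ hm (by abel)
      change polar c a b = 1
      rw [polar, h _ hab, h _ ha, h _ hb.1]; simp
  have key2 : ∀ a b, polar c a b = 1 := by
    intro a b
    rw [polar_comm]
    refine hom_trivial_of_small_support (hc.polarHom b) T (by omega) ?_ a
    intro a ha
    change polar c b a = 1
    rw [polar_comm]; exact key a ha b
  refine hom_trivial_of_small_support
    (MonoidHom.mk' (fun w => c w.toAdd) fun a b => ?_) T (by omega) h w
  simp [map_add_eq_polar c a.toAdd b.toAdd, key2]

end Quadratic

/-! ### Schur's lemma for absolutely irreducible groups -/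

section Schur

variable {K V : Type*} [Field K] [AddCommGroup V] [Module K V]

lemma eq_bot_or_eq_top_of_invariant {N : Subgroup (V ≃ₗ[K] V)} (hN : IsAbsolutelyIrreducible N)
    (U : Submodule K V) (hU : ∀ g ∈ N, ∀ x ∈ U, g x ∈ U) : U = ⊥ ∨ U = ⊤ := by
  have := hN.2 (U.baseChange (AlgebraicClosure K)) (by
    intro g hg x hx
    have hle : U.baseChange (AlgebraicClosure K) ≤
        (U.baseChange (AlgebraicClosure K)).comap
          (LinearMap.baseChange (AlgebraicClosure K) (g : V →ₗ[K] V)) := by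
      rw [Submodule.baseChange_eq_span, Submodule.span_le]
      rintro _ ⟨y, hy, rfl⟩
      simp only [Submodule.comap_coe, Set.mem_preimage, SetLike.mem_coe]
      rw [← Submodule.baseChange_eq_span]
      simpa using Submodule.tmul_mem_baseChange_of_mem (1 : AlgebraicClosure K) (hU g hg y hy)
    exact hle hx)
  rwa [← Submodule.baseChange_bot, ← Submodule.baseChange_top, Submodule.baseChange_inj,
    Submodule.baseChange_inj] at this

/-- Over the algebraic closure `g` has an eigenvalue `μ`, whose eigenspace is `N`-invariant and
hence everything. In a `K`-basis, `μ` is a quotient of two coordinates in `K`, so it descends to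
`K`. -/
lemma mem_scalarGroup_of_commute [Module.Finite K V] {N : Subgroup (V ≃ₗ[K] V)}
    (hN : IsAbsolutelyIrreducible N) (g : V ≃ₗ[K] V) (hg : ∀ x ∈ N, g * x = x * g) :
    g ∈ scalarGroup K V := by
  have := hN.1
  let L := AlgebraicClosure K
  let f : L ⊗[K] V →ₗ[L] L ⊗[K] V := LinearMap.baseChange L (g : V →ₗ[K] V)
  have : Nontrivial (L ⊗[K] V) :=
    (Module.FaithfullyFlat.nontrivial_tensorProduct_iff_right K L).2 hN.1
  obtain ⟨μ, hμ⟩ := Module.End.exists_eigenvalue f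
  have htop : Module.End.eigenspace f μ = ⊤ := by
    refine (hN.2 (Module.End.eigenspace f μ) ?_).resolve_left hμ
    intro x hx v hv
    rw [Module.End.mem_eigenspace_iff] at hv ⊢
    have hcomm : f ∘ₗ LinearMap.baseChange L (x : V →ₗ[K] V) =
        LinearMap.baseChange L (x : V →ₗ[K] V) ∘ₗ f := by
      simp only [f]
      rw [← LinearMap.baseChange_comp, ← LinearMap.baseChange_comp]
      congr 1
      ext v
      exact DFunLike.congr_fun (hg x hx) v
    have := LinearMap.congr_fun hcomm v
    simp only [LinearMap.comp_apply] at this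
    rw [this, hv, map_smul]
  have hv : ∀ v : V, (1 : L) ⊗ₜ[K] g v = μ ⊗ₜ[K] v := by
    intro v
    have := Module.End.mem_eigenspace_iff.1
      (htop ▸ Submodule.mem_top : (1 : L) ⊗ₜ[K] v ∈ Module.End.eigenspace f μ)
    simpa [f, TensorProduct.smul_tmul'] using this
  let b := Module.finBasis K V
  have hrep : ∀ v i, algebraMap K L (b.repr (g v) i) = μ * algebraMap K L (b.repr v i) := by
    intro v i
    have := congrArg (fun t => (b.baseChange L).repr t i) (hv v)
    simpa [Algebra.smul_def, mul_comm] using this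
  obtain ⟨v, hv0⟩ := exists_ne (0 : V)
  obtain ⟨i, hi⟩ : ∃ i, b.repr v i ≠ 0 := by
    by_contra! h
    exact hv0 (b.repr.injective (Finsupp.ext (by simpa using h)))
  have hinj := (algebraMap K L).injective
  set k := b.repr (g v) i / b.repr v i
  have hμk : μ = algebraMap K L k := by
    have h0 : algebraMap K L (b.repr v i) ≠ 0 := by simpa using hi
    rw [map_div₀, hrep, mul_div_cancel_right₀ _ h0]
  have hgk : ∀ v, g v = k • v := by
    intro v
    apply b.repr.injective
    ext j
    apply hinj
    rw [hrep, hμk]; simp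
  have hk : k ≠ 0 := by
    intro hk
    have := hgk v
    rw [hk, zero_smul] at this
    exact hv0 (g.injective (by rw [this, map_zero]))
  exact ⟨Units.mk0 k hk, hgk⟩

end Schur

/-! ### Stabilisers of `u 0` act monomially with quadratic coefficients -/

section Monomial

variable {K V W : Type*} [Field K] [AddCommGroup V] [Module K V] [AddCommGroup W]
  {G Z N D D₁ S : Subgroup (V ≃ₗ[K] V)} {u : Module.Basis W K V} {r : ℕ}

omit [AddCommGroup W] in
lemma smul_basis_inj (u : Module.Basis W K V) {w : W} {a b : K} (h : a • u w = b • u w) :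
    a = b :=
  smul_left_injective K (u.ne_zero w) h

omit [AddCommGroup W] in
/-- A nonzero multiple of a basis vector determines its label. -/
lemma label_inj (u : Module.Basis W K V) {v w : W} {a b : K} (ha : a ≠ 0)
    (h : a • u v = b • u w) : v = w := by
  classical
  have := congrArg (fun x => u.repr x v) h
  by_contra hne
  simp [Ne.symm hne, ha] at this

lemma IsOfSymplecticType.exists_commutator_scalar (hG : IsOfSymplecticType G Z N r)
    (hZ : Z = scalarGroup K V) {x y : V ≃ₗ[K] V} (hx : x ∈ N) (hy : y ∈ N) :
    ∃ ζ : Kˣ, ∀ v, x (y v) = (ζ : K) • y (x v) := by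
  have h := hG.comm_mem x hx y hy
  rw [hZ] at h
  obtain ⟨ζ, hζ⟩ := h
  refine ⟨ζ, fun v => ?_⟩
  rw [← hζ]
  have h2 : x * y = x * y * x⁻¹ * y⁻¹ * (y * x) := by group
  exact DFunLike.congr_fun h2 v

lemma IsOfSymplecticType.conj_mem (hG : IsOfSymplecticType G Z N r) {g x : V ≃ₗ[K] V}
    (hg : g ∈ G) (hx : x ∈ N) : g * x * g⁻¹ ∈ N :=
  hG.normal.conj_mem ⟨x, hG.N_le_G hx⟩ hx ⟨g, hg⟩

namespace IsMonomialFrame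

variable (h : IsMonomialFrame Z N D D₁ S u)
include h

lemma D_le : D ≤ N := h.sup_eq ▸ le_sup_left

lemma S_le : S ≤ N := h.sup_eq ▸ le_sup_right

lemma exists_translation (a : W) : ∃ s ∈ S, ∀ w, s (u w) = u (a + w) := by
  have : ∀ w, (u.equiv u (Equiv.addLeft a)) (u w) = u (a + w) := fun w => by simp
  exact ⟨_, (h.mem_S _).2 ⟨a, this⟩, this⟩

lemma exists_mul_of_mem {n : V ≃ₗ[K] V} (hn : n ∈ N) : ∃ d ∈ D, ∃ s ∈ S, n = d * s := by
  have := h.normal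
  have htop : D.subgroupOf N ⊔ S.subgroupOf N = ⊤ := by
    rw [← Subgroup.subgroupOf_sup h.D_le h.S_le, h.sup_eq, Subgroup.subgroupOf_self]
  have hm : (⟨n, hn⟩ : N) ∈ D.subgroupOf N ⊔ S.subgroupOf N := htop ▸ Subgroup.mem_top _
  obtain ⟨d, hd, s, hs, hds⟩ := Subgroup.mem_sup_of_normal_left.1 hm
  exact ⟨d, hd, s, hs, congrArg Subtype.val hds.symm⟩

lemma exists_weight {d : V ≃ₗ[K] V} (hd : d ∈ D) (w : W) : ∃ c : Kˣ, d (u w) = (c : K) • u w := by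
  obtain ⟨c, hc⟩ := h.diagonal d hd w
  have : c ≠ 0 := by
    rintro rfl
    rw [zero_smul] at hc
    exact u.ne_zero w (d.injective (by rw [hc, map_zero]))
  exact ⟨Units.mk0 c this, hc⟩

/-- The weights of an element of `D` form a multiple of a character of `W`. -/
lemma exists_character (hG : IsOfSymplecticType G Z N r) (hZ : Z = scalarGroup K V)
    {d : V ≃ₗ[K] V} (hd : d ∈ D) :
    ∃ μ ζ : W → Kˣ, (∀ w, d (u w) = (μ w : K) • u w) ∧ ∀ a w, μ (a + w) = ζ a * μ w := by
  choose μ hμ using h.exists_weight hd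
  choose s hs hsu using h.exists_translation
  -- The commutator of `d` with translation by `a` is a scalar, so shifting a label by `a` changes
  -- the weight by a factor independent of the label.
  choose ζ hζ using fun a => hG.exists_commutator_scalar hZ (h.D_le hd) (h.S_le (hs a))
  refine ⟨μ, ζ, hμ, fun a w => ?_⟩
  have := hζ a (u w)
  rw [hsu, hμ, hμ, map_smul, hsu, smul_smul] at this
  exact Units.ext (smul_basis_inj u this)

variable [Module.Finite K V]

/-- The lines spanned by the basis vectors are pairwise non-isomorphic `D`-modules. -/
lemma eq_of_weights_eq (hG : IsOfSymplecticType G Z N r) (hZ : Z = scalarGroup K V) {v w : W}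
    (hvw : ∀ d ∈ D, ∃ c : K, d (u v) = c • u v ∧ d (u w) = c • u w) : v = w := by
  -- This translation takes `u v` to `u w`. Equal weights force its scalar commutators with `D` to
  -- be `1`; as `S` is abelian, it centralises `N` and is scalar, which is possible only for the
  -- trivial translation.
  obtain ⟨s, hs, hsu⟩ := h.exists_translation (w - v)
  have hsD : ∀ d ∈ D, d * s = s * d := by
    intro d hd
    obtain ⟨ζ, hζ⟩ := hG.exists_commutator_scalar hZ (h.D_le hd) (h.S_le hs)
    obtain ⟨c, hcv, hcw⟩ := hvw d hd
    have h1 := hζ (u v)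
    rw [hsu, sub_add_cancel, hcw, hcv, map_smul, hsu, sub_add_cancel, smul_smul] at h1
    have hc : c ≠ 0 := by
      rintro rfl
      rw [zero_smul] at hcv
      exact u.ne_zero v (d.injective (by rw [hcv, map_zero]))
    have h2 : (ζ : K) = 1 := by
      have := smul_basis_inj u h1
      exact (mul_eq_right₀ hc).1 this.symm
    ext x
    simpa [h2] using hζ x
  have hsS : ∀ t ∈ S, t * s = s * t := by
    intro t ht
    obtain ⟨b, hb⟩ := (h.mem_S t).1 ht
    apply LinearEquiv.toLinearMap_injective
    refine u.ext fun x => ?_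
    simp [hsu, hb, add_left_comm]
  have hsc : s ∈ scalarGroup K V := by
    refine mem_scalarGroup_of_commute hG.absIrred s fun x hx => ?_
    obtain ⟨d, hd, t, ht, rfl⟩ := h.exists_mul_of_mem hx
    rw [mul_assoc, hsS t ht, ← mul_assoc, ← hsD d hd, mul_assoc]
  obtain ⟨c, hc⟩ := hsc
  have h0 := hsu 0
  rw [hc, add_zero] at h0
  have := label_inj u c.ne_zero (h0.trans (one_smul K _).symm)
  exact (sub_eq_zero.1 this.symm).symm

omit [Module.Finite K V] in
-- Modulo `D` an element of `N` is a translation, and one keeping the line of `u 0` must be the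
-- trivial one. This describes `D` in terms of `N` and `u 0` alone, so elements of `G` that fix `u
-- 0` normalise it.
lemma mem_D_of_fixes {n : V ≃ₗ[K] V} (hn : n ∈ N) {c : K} (hc : n (u 0) = c • u 0) :
    n ∈ D := by
  obtain ⟨d, hd, s, hs, rfl⟩ := h.exists_mul_of_mem hn
  obtain ⟨a, ha⟩ := (h.mem_S s).1 hs
  obtain ⟨μ, hμ⟩ := h.exists_weight hd a
  have h0 : a = 0 := by
    rw [LinearEquiv.mul_apply, ha, add_zero, hμ] at hc
    exact label_inj u μ.ne_zero hc
  have : s = 1 := by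
    apply LinearEquiv.toLinearMap_injective
    refine u.ext fun x => ?_
    simp [ha, h0]
  rwa [this, mul_one]

/-- Since `g` normalises `D`, the vector `g (u w)` is a common eigenvector of `D`. Distinct basis
lines have distinct weights, so only one of its coordinates is nonzero. -/
lemma exists_monomial (hG : IsOfSymplecticType G Z N r) (hZ : Z = scalarGroup K V)
    {g : V ≃ₗ[K] V} (hg : g ∈ G) {w : W} (hg0 : g (u 0) = u 0) :
    ∃ (c : Kˣ) (w' : W), g (u w) = (c : K) • u w' := by
  have hne : u.repr (g (u w)) ≠ 0 := by
    intro h0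
    have := u.repr.map_eq_zero_iff.1 h0
    exact u.ne_zero w (g.injective (by rw [this, map_zero]))
  have hD : ∀ d ∈ D, g⁻¹ * d * g ∈ D := by
    intro d hd
    obtain ⟨c, hc⟩ := h.diagonal d hd 0
    have hgi : g⁻¹ (u 0) = u 0 := g.injective (by
      rw [← LinearEquiv.mul_apply, mul_inv_cancel, LinearEquiv.coe_one, id, hg0])
    refine h.mem_D_of_fixes (c := c) ?_ ?_
    · simpa using hG.conj_mem (G.inv_mem hg) (h.D_le hd)
    · simp only [LinearEquiv.mul_apply, hg0, hc, map_smul, hgi]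
  obtain ⟨v, hv⟩ := Finsupp.ne_iff.1 hne
  have hsupp : ∀ v', u.repr (g (u w)) v' ≠ 0 → v' = v := by
    intro v' hv'
    refine h.eq_of_weights_eq hG hZ fun d hd => ?_
    obtain ⟨μ, -, hμ, -⟩ := h.exists_character hG hZ hd
    obtain ⟨c, hc⟩ := h.diagonal _ (hD d hd) w
    have hdg : d (g (u w)) = c • g (u w) := by
      rw [← map_smul, ← hc]
      simp only [← LinearEquiv.mul_apply]
      congr 1; group
    have hcoord : ∀ x y, u.repr (d y) x = μ x * u.repr y x := by
      intro x y
      have : (u.coord x) ∘ₗ (d : V →ₗ[K] V) = (μ x : K) • u.coord x := by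
        classical
        refine u.ext fun z => ?_
        simp only [LinearMap.comp_apply, LinearEquiv.coe_coe, hμ, map_smul,
          Module.Basis.coord_apply, LinearMap.smul_apply, Module.Basis.repr_self,
          Finsupp.single_apply, smul_eq_mul]
        split_ifs with hz
        · rw [hz]
        · simp
      exact LinearMap.congr_fun this y
    have hx : ∀ x, u.repr (g (u w)) x ≠ 0 → (μ x : K) = c := by
      intro x hx
      have := hcoord x (g (u w))
      rw [hdg, map_smul, Finsupp.smul_apply, smul_eq_mul] at this
      exact (mul_right_cancel₀ hx this).symm
    exact ⟨c, by rw [hμ, hx _ hv'], by rw [hμ, hx _ hv]⟩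
  refine ⟨Units.mk0 _ hv, v, ?_⟩
  apply u.repr.injective
  ext x
  by_cases hx : x = v
  · subst hx; simp
  · have : u.repr (g (u w)) x = 0 := by
      by_contra h0; exact hx (hsupp x h0)
    rw [this]; simp [Ne.symm hx]

/-- An element of `G` that fixes `u 0` permutes the lines spanned by the basis vectors by an
additive permutation of the labels, with coefficients given by a quadratic function. -/
theorem exists_quadratic (hG : IsOfSymplecticType G Z N r) (hZ : Z = scalarGroup K V)
    {g : V ≃ₗ[K] V} (hg : g ∈ G) (hg0 : g (u 0) = u 0) :
    ∃ (σ : W ≃+ W) (c : W → Kˣ), IsQuadratic c ∧ ∀ w, g (u w) = (c w : K) • u (σ w) := by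
  have : Finite W := Module.Finite.finite_basis u
  choose c σ hcσ using fun w => h.exists_monomial hG hZ hg hg0 (w := w)
  have hσ0 : σ 0 = 0 := by
    have h0 := hcσ 0
    rw [hg0] at h0
    exact label_inj u (c 0).ne_zero (h0.symm.trans (one_smul K _).symm)
  have hc0 : c 0 = 1 := by
    have h0 := hcσ 0
    rw [hg0, hσ0] at h0
    exact Units.ext (smul_basis_inj u (h0.symm.trans (one_smul K _).symm))
  -- Conjugating the translation `s` by `g` gives `d * t` with `d ∈ D` and `t` a translation by some
  -- `b`. Comparing `g * s` with `d * t * g` on `u w` yields both the labels and the coefficients.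
  have key : ∀ a, ∃ b, (∀ w, σ (a + w) = b + σ w) ∧ ∃ μ ζ : W → Kˣ,
      (∀ x y, μ (x + y) = ζ x * μ y) ∧ ∀ w, c (a + w) = μ (σ (a + w)) * c w := by
    intro a
    obtain ⟨s, hs, hsu⟩ := h.exists_translation a
    obtain ⟨d, hd, t, ht, hdt⟩ := h.exists_mul_of_mem (hG.conj_mem hg (h.S_le hs))
    obtain ⟨b, hb⟩ := (h.mem_S t).1 ht
    obtain ⟨μ, ζ, hμ, hζ⟩ := h.exists_character hG hZ hd
    have hw : ∀ w, (c (a + w) : K) • u (σ (a + w)) =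
        ((c w : K) * μ (b + σ w)) • u (b + σ w) := by
      intro w
      have e1 : (g * s) (u w) = (d * t * g) (u w) := by rw [← hdt]; group
      simpa only [LinearEquiv.mul_apply, hsu, hcσ, hb, map_smul, hμ, smul_smul] using e1
    have hσ : ∀ w, σ (a + w) = b + σ w := fun w => label_inj u (c (a + w)).ne_zero (hw w)
    refine ⟨b, hσ, μ, ζ, hζ, fun w => ?_⟩
    have := hw w
    rw [← hσ] at this
    rw [mul_comm]
    exact Units.ext (smul_basis_inj u this)
  have hadd : ∀ a w, σ (a + w) = σ a + σ w := by
    intro a w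
    obtain ⟨b, hb, -⟩ := key a
    have := hb 0
    rw [add_zero, hσ0, add_zero] at this
    rw [this, hb]
  have hinj : Function.Injective σ := by
    intro v w hvw
    refine label_inj u (a := (c v : K)⁻¹) (b := (c w : K)⁻¹) (by simp) (g.injective ?_)
    rw [map_smul, map_smul, hcσ, hcσ, hvw, smul_smul, smul_smul]
    simp
  refine ⟨AddEquiv.ofBijective (AddMonoidHom.mk' σ hadd)
    (Finite.injective_iff_bijective.1 hinj), c, ⟨hc0, fun a b d => ?_⟩, hcσ⟩
  obtain ⟨-, -, μ, ζ, hζ, hμ⟩ := key a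
  have h0 := hμ 0
  rw [add_zero, hc0, mul_one] at h0
  -- So the polarisation of `c` at `a` is `ζ ∘ σ`, which is multiplicative in `w`; this is the
  -- required vanishing of third differences.
  have e : ∀ w, c (a + w) = ζ (σ w) * c a * c w := by
    intro w
    rw [hμ, add_comm a w, hadd, hζ, h0]
  have hζm : ζ (σ (b + d)) = ζ (σ b) * ζ (σ d) := by
    have h1 := hζ (σ b + σ d) 0
    rw [add_assoc, hζ, hζ, ← mul_assoc, ← hadd] at h1
    exact (mul_right_cancel h1).symm
  rw [add_assoc, e, e b, e d, hζm]
  simp only [mul_comm, mul_left_comm]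

end IsMonomialFrame

end Monomial

/-! ### Base pairs in the generic cases -/

section BasePairs

variable {K V : Type*} [Field K] [AddCommGroup V] [Module K V]

/-- If a generator of `Kˣ` has odd order, then the number of vectors is even. -/
lemma even_card_of_generator_pow_eq_one [Finite K] [Module.Finite K V]
    (hn : 1 < Module.finrank K V) {r : ℕ} (hr : Odd r) {α : Kˣ}
    (hα : ∀ β : Kˣ, β ∈ Subgroup.zpowers α) (h : α ^ r = 1) : Even (Nat.card V) := by
  have h1 : Nat.card Kˣ ∣ r := by
    rw [← orderOf_eq_card_of_forall_mem_zpowers hα]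
    exact orderOf_dvd_of_pow_eq_one h
  have h2 : Odd (Nat.card Kˣ) := hr.of_dvd_nat h1
  have h3 : Even (Nat.card K) := by
    rw [Nat.card_units] at h2
    have := Nat.card_pos (α := K)
    have := h2.add_one
    rwa [Nat.sub_add_cancel (by omega)] at this
  rw [Module.natCard_eq_pow_finrank (K := K)]
  exact h3.pow_of_ne_zero (by omega)

/-- In a group of odd order, no element induces a nontrivial involution on the lines spanned by the
basis vectors. -/
lemma perm_eq_of_odd_card {W : Type*} {G : Subgroup (V ≃ₗ[K] V)} (hG : Odd (Nat.card G))
    (u : Module.Basis W K V) {g : V ≃ₗ[K] V} (hg : g ∈ G) {σ : W → W} {c : W → Kˣ}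
    (hgu : ∀ w, g (u w) = (c w : K) • u (σ w)) (hσ : ∀ w, σ (σ w) = w) (w : W) : σ w = w := by
  obtain ⟨m, hm⟩ := hG
  have hpow : g ^ (2 * m + 1) = 1 := by
    have : (⟨g, hg⟩ : G) ^ Nat.card G = 1 := pow_card_eq_one'
    rw [hm] at this
    exact congrArg Subtype.val this
  -- Even powers of `g` keep the line of `u (σ w)`, so the odd power `g ^ |G| = 1` sends the line of
  -- `u w` to that of `u (σ w)`.
  have heven : ∀ j : ℕ, ∃ b : Kˣ, (g ^ (2 * j)) (u (σ w)) = (b : K) • u (σ w) := by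
    intro j
    induction j with
    | zero => exact ⟨1, by simp⟩
    | succ j ih =>
      obtain ⟨b, hb⟩ := ih
      refine ⟨c w * c (σ w) * b, ?_⟩
      rw [show 2 * (j + 1) = 1 + 1 + 2 * j by ring, pow_add, LinearEquiv.mul_apply, hb, pow_add,
        pow_one, LinearEquiv.mul_apply, map_smul, map_smul, hgu, map_smul, hσ, hgu, smul_smul,
        smul_smul]
      congr 1
      push_cast
      ring
  obtain ⟨b, hb⟩ := heven m
  have h1 : (g ^ (2 * m + 1)) (u w) = u w := by rw [hpow]; rfl
  rw [pow_succ, LinearEquiv.mul_apply, hgu, map_smul, hb, smul_smul] at h1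
  refine label_inj u (a := (c w : K) * b) (b := 1) (by simp) ?_
  rw [h1, one_smul]

/-- How the coordinates of a vector fixed by a monomial transformation are permuted. -/
lemma repr_of_fixed {W : Type*} (u : Module.Basis W K V) {g : V ≃ₗ[K] V} {σ : W → W}
    (hinj : Function.Injective σ) {c : W → Kˣ} (hgu : ∀ w, g (u w) = (c w : K) • u (σ w)) {y : V}
    (hy : g y = y) (w : W) : u.repr y (σ w) = c w * u.repr y w := by
  classical
  have : (u.coord (σ w)) ∘ₗ (g : V →ₗ[K] V) = (c w : K) • u.coord w := by
    refine u.ext fun z => ?_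
    simp only [LinearMap.comp_apply, LinearEquiv.coe_coe, hgu, map_smul, Module.Basis.coord_apply,
      LinearMap.smul_apply, Module.Basis.repr_self, Finsupp.single_apply, smul_eq_mul, hinj.eq_iff]
    split_ifs with hz
    · rw [hz]
    · simp
  have h2 := LinearMap.congr_fun this y
  simpa [hy] using h2

variable {r : ℕ} {G Z N D D₁ S : Subgroup (V ≃ₗ[K] V)}

namespace IsMonomialFrame

section

variable {W : Type*} [AddCommGroup W] {u : Module.Basis W K V}

/-- A criterion for `C_G(u 0) ∩ C_G(y) = 1` in terms of permutations and coefficients. -/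
lemma isBasePair [Module.Finite K V] (h : IsMonomialFrame Z N D D₁ S u)
    (hG : IsOfSymplecticType G Z N r)
    (hZ : Z = scalarGroup K V) {y : V}
    (hy : ∀ g ∈ G, ∀ (σ : W ≃+ W) (c : W → Kˣ), IsQuadratic c →
      (∀ w, g (u w) = (c w : K) • u (σ w)) → (∀ w, u.repr y (σ w) = c w * u.repr y w) →
      (∀ w, σ w = w) ∧ ∀ w, c w = 1) :
    IsBasePair G (u 0) y := by
  rw [IsBasePair, eq_bot_iff]
  rintro ⟨g, hg⟩ ⟨h0, h1⟩
  have h0' : g (u 0) = u 0 := h0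
  have h1' : g y = y := h1
  obtain ⟨σ, c, hc, hgu⟩ := h.exists_quadratic hG hZ hg h0'
  obtain ⟨hσ, hc1⟩ := hy g hg σ c hc hgu (repr_of_fixed u σ.injective hgu h1')
  rw [Subgroup.mem_bot]
  refine Subtype.ext (LinearEquiv.toLinearMap_injective (u.ext fun w => ?_))
  simp [hgu, hσ, hc1]

/-- If `Kˣ` were trivial, all weights of `D` would be `1` and could not separate the labels `a` and
`0`. -/
lemma exists_unit_ne_one [Module.Finite K V] (h : IsMonomialFrame Z N D D₁ S u)
    (hG : IsOfSymplecticType G Z N r)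
    (hZ : Z = scalarGroup K V) {a : W} (ha : a ≠ 0) : ∃ β : Kˣ, β ≠ 1 := by
  by_contra! hβ
  refine ha (h.eq_of_weights_eq hG hZ fun d hd => ⟨1, ?_, ?_⟩)
  · obtain ⟨c, hc⟩ := h.exists_weight hd a
    rw [hc, hβ c, Units.val_one]
  · obtain ⟨c, hc⟩ := h.exists_weight hd 0
    rw [hc, hβ c, Units.val_one]

lemma generator_ne_one [Module.Finite K V] (h : IsMonomialFrame Z N D D₁ S u)
    (hG : IsOfSymplecticType G Z N r)
    (hZ : Z = scalarGroup K V) {a : W} (ha : a ≠ 0) {α : Kˣ}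
    (hα : ∀ β : Kˣ, β ∈ Subgroup.zpowers α) : α ≠ 1 := by
  rintro rfl
  obtain ⟨β, hβ⟩ := h.exists_unit_ne_one hG hZ ha
  have := hα β
  rw [Subgroup.zpowers_one_eq_bot, Subgroup.mem_bot] at this
  exact hβ this

end

section

variable {k : ℕ} {u : Module.Basis (Fin k → ZMod r) K V}

lemma nsmul_eq_zero_zmod (w : Fin k → ZMod r) : r • w = 0 := by
  ext i; simp

lemma addEquiv_eq_of_basis (e : Module.Basis (Fin k) (ZMod r) (Fin k → ZMod r))
    (σ : (Fin k → ZMod r) ≃+ (Fin k → ZMod r)) (hσ : ∀ i, σ (e i) = e i) (w : Fin k → ZMod r) :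
    σ w = w := by
  have : AddMonoidHom.toZModLinearMap r σ.toAddMonoidHom = LinearMap.id :=
    e.ext fun i => by simpa using hσ i
  exact LinearMap.congr_fun this w

variable [Fact r.Prime] [Module.Finite K V]

/-- The base in the case `k = 1`, `|W| ≠ 3`. -/
lemma isBasePair_rank_one (h : IsMonomialFrame Z N D D₁ S u) (hG : IsOfSymplecticType G Z N r)
    (hZ : Z = scalarGroup K V) (hr : 3 ≤ r)
    (e : Module.Basis (Fin k) (ZMod r) (Fin k → ZMod r)) (hk : 0 < k) (hk1 : k = 1)
    (hr3 : r ^ k ≠ 3) :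
    IsBasePair G (u 0) (∑ w ∈ ({e ⟨0, hk⟩} : Finset (Fin k → ZMod r))ᶜ, u w) := by
  subst hk1
  rw [pow_one] at hr3
  have hp : r.Prime := Fact.out
  have hr4 : r ≠ 4 := by rintro rfl; revert hp; decide
  have hr5 : 5 ≤ r := by omega
  set a := e ⟨0, hk⟩ with ha
  have ha0 : a ≠ 0 := e.ne_zero _
  have hja : ∀ j : ℕ, 0 < j → j < r → (j : ZMod r) • a ≠ 0 := by
    intro j h0 hj
    refine smul_ne_zero (fun h => ?_) ha0
    exact absurd (Nat.le_of_dvd h0 ((ZMod.natCast_eq_zero_iff j r).1 h)) (by omega)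
  refine h.isBasePair hG hZ fun g hg σ c hc hgu hY => ?_
  have hrep : ∀ w, u.repr (∑ w ∈ ({a} : Finset (Fin 1 → ZMod r))ᶜ, u w) w =
      if w = a then 0 else 1 := by
    intro w
    simp [Finsupp.single_apply]
  simp only [hrep] at hY
  have hσa : σ a = a := by
    by_contra hne
    have := hY a
    simp [hne] at this
  have hσ := addEquiv_eq_of_basis e σ (fun i => by
    rw [show i = ⟨0, hk⟩ from Subsingleton.elim _ _]; exact hσa)
  have hc1 : ∀ w, w ≠ a → c w = 1 := by
    intro w hw
    have := hY w
    rw [hσ, if_neg hw, mul_one] at this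
    exact Units.ext this.symm
  refine ⟨hσ, fun w => ?_⟩
  rcases eq_or_ne w a with rfl | hw
  swap
  · exact hc1 w hw
  -- As `r ≥ 5`, the points `2a`, `3a`, `4a` differ from `a`, so `c` is `1` there. The cube
  -- identities at `(a, a, a)` and `(a, a, 2a)` then give `c a ^ 3 = 1` and `c a ^ 2 = 1`.
  have h1 := hja 1 (by norm_num) (by omega)
  have h2 := hja 2 (by norm_num) (by omega)
  have h3 := hja 3 (by norm_num) (by omega)
  have e2 : c (a + a) = 1 := hc1 _ fun hh => h1 (by
    rw [Nat.cast_one, one_smul]; exact left_eq_add.1 hh.symm)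
  have e3 : c (a + (a + a)) = 1 := hc1 _ fun hh => h2 (by
    rw [Nat.cast_ofNat, ofNat_smul_eq_nsmul, two_nsmul]; exact left_eq_add.1 hh.symm)
  have e4 : c (a + (a + a + a)) = 1 := hc1 _ fun hh => h3 (by
    rw [Nat.cast_ofNat, ofNat_smul_eq_nsmul, succ_nsmul, two_nsmul]; exact left_eq_add.1 hh.symm)
  have q1 := hc.cube a a a
  have q2 := hc.cube a a (a + a)
  rw [add_assoc, e2, e3] at q1
  rw [show a + a + (a + a) = a + (a + a + a) by abel, e2, e3, e4] at q2
  simp only [one_mul, mul_one] at q1 q2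
  rwa [q2, one_mul] at q1

/-- The base given by a regular partition. -/
lemma isBasePair_of_isRegularPartition (h : IsMonomialFrame Z N D D₁ S u)
    (hG : IsOfSymplecticType G Z N r) (hZ : Z = scalarGroup K V) {E : Fin k → ZMod r} (hE : E ≠ 0)
    {α : Kˣ} (hα : ∀ β : Kˣ, β ∈ Subgroup.zpowers α) {Ω₂ Ω₃ : Finset (Fin k → ZMod r)}
    (hreg : IsRegularPartition (permPart G u) ![{E}, Ω₂, Ω₃])
    (hcard : 4 * (Ω₂.card + 2) < r ^ k) :
    IsBasePair G (u 0) ((α : K) • u E + ∑ w ∈ Ω₃, u w) := by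
  have hcW : Fintype.card (Fin k → ZMod r) = r ^ k := by simp [ZMod.card]
  have hE2 : E ∉ Ω₂ := by
    have : Disjoint ({E} : Finset (Fin k → ZMod r)) Ω₂ :=
      hreg.disjoint (show (0 : Fin 3) ≠ 1 by decide)
    simpa using this
  have hE3 : E ∉ Ω₃ := by
    have : Disjoint ({E} : Finset (Fin k → ZMod r)) Ω₃ :=
      hreg.disjoint (show (0 : Fin 3) ≠ 2 by decide)
    simpa using this
  have h23 : Disjoint Ω₂ Ω₃ := hreg.disjoint (show (1 : Fin 3) ≠ 2 by decide)
  have hcov : ∀ w, w = E ∨ w ∈ Ω₂ ∨ w ∈ Ω₃ := by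
    intro w
    obtain ⟨i, hi⟩ := hreg.cover w
    fin_cases i
    · exact Or.inl (by simpa using hi)
    · exact Or.inr (Or.inl hi)
    · exact Or.inr (Or.inr hi)
  refine h.isBasePair hG hZ fun g hg σ c hc hgu hY => ?_
  have hrep : ∀ w, u.repr ((α : K) • u E + ∑ w ∈ Ω₃, u w) w =
      (if w = E then (α : K) else 0) + if w ∈ Ω₃ then 1 else 0 := by
    intro w
    simp [Finsupp.single_apply, eq_comm]
  simp only [hrep] at hY
  have hg0 : g (u 0) = u 0 := by
    rw [hgu, map_zero, hc.map_zero, Units.val_one, one_smul]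
  -- The coordinates of `y` are `α` at `E`, `0` exactly on `Ω₂`, and `1` on `Ω₃`; the zero set is
  -- preserved because the values of `c` are units.
  have hΩ2 : ∀ w ∈ Ω₂, σ w ∈ Ω₂ := by
    intro w hw
    have hwE : w ≠ E := fun hh => hE2 (hh ▸ hw)
    have hw3 : w ∉ Ω₃ := Finset.disjoint_left.1 h23 hw
    have := hY w
    rw [if_neg hwE, if_neg hw3] at this
    rcases hcov (σ w) with h1 | h1 | h1
    · simp [h1, hE3] at this
    · exact h1
    · have h2 : σ w ≠ E := fun hh => hE3 (hh ▸ h1)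
      simp [h1, h2] at this
  have hΩ3 : ∀ w ∈ Ω₃, σ w ≠ E → σ w ∈ Ω₃ ∧ c w = 1 := by
    intro w hw hσw
    have hwE : w ≠ E := fun hh => hE3 (hh ▸ hw)
    have := hY w
    rw [if_neg hwE, if_pos hw, if_neg hσw] at this
    split_ifs at this with h3
    · exact ⟨h3, Units.ext (by simpa using this.symm)⟩
    · exact absurd this.symm (by simp)
  by_cases hσE : σ E = E
  · have hcE : c E = 1 := by
      have := hY E
      rw [hσE, if_pos rfl, if_neg hE3, add_zero] at this
      exact Units.ext ((mul_eq_right₀ α.ne_zero).1 this.symm)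
    have hc3 : ∀ w ∈ Ω₃, σ w ∈ Ω₃ ∧ c w = 1 := fun w hw => hΩ3 w hw fun hh =>
      hE3 (σ.injective (hh.trans hσE.symm) ▸ hw)
    have himg : ∀ P : Finset (Fin k → ZMod r), (∀ w ∈ P, σ w ∈ P) →
        σ.toEquiv '' (P : Set (Fin k → ZMod r)) = P := by
      intro P hP
      have : P.image σ = P := by
        refine Finset.eq_of_subset_of_card_le (fun x hx => ?_)
          (Finset.card_image_of_injective P σ.injective).ge
        obtain ⟨w, hw, rfl⟩ := Finset.mem_image.1 hx
        exact hP w hw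
      conv_rhs => rw [← this]
      simp
    have hσ1 : σ.toEquiv = 1 := by
      refine hreg.regular _ ⟨g, hg, hg0, fun w => ⟨c w, hgu w⟩⟩ fun i => ?_
      fin_cases i
      · simp [hσE]
      · exact himg Ω₂ hΩ2
      · exact himg Ω₃ fun w hw => (hc3 w hw).1
    refine ⟨fun w => DFunLike.congr_fun hσ1 w, hc.eq_one_of_small_support Ω₂ (by omega) ?_⟩
    intro w hw
    rcases hcov w with rfl | h2 | h3
    · exact hcE
    · exact absurd h2 hw
    · exact (hc3 w h3).2
  -- If `σ` moves `E`, let `σ f = E`. Then `c f = α`, and `c` is `1` off `Ω₂ ∪ {E, f}`. The `+ 2` in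
  -- the size bound pays for these two extra points, and `α = 1` follows, a contradiction.
  · exfalso
    obtain ⟨f, hf⟩ := σ.surjective E
    have hfE : f ≠ E := by rintro rfl; exact hσE hf
    have hcf : c f = α := by
      have := hY f
      rw [hf, if_pos rfl, if_neg hE3, if_neg hfE, add_zero, zero_add] at this
      split_ifs at this
      · exact Units.ext (by simpa using this.symm)
      · simp at this
    refine h.generator_ne_one hG hZ hE hα ?_
    rw [← hcf]
    refine hc.eq_one_of_small_support (insert E (insert f Ω₂)) ?_ ?_ f
    · have h1 := Finset.card_insert_le E (insert f Ω₂)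
      have h2 := Finset.card_insert_le f Ω₂
      omega
    · intro w hw
      simp only [Finset.mem_insert, not_or] at hw
      have h3 := ((hcov w).resolve_left hw.1).resolve_left hw.2.2
      exact (hΩ3 w h3 fun hh => hw.2.1 (σ.injective (hh.trans hf.symm))).2

end

end IsMonomialFrame

end BasePairs

/-! ### Rigidity and size of the standard partition -/

section StandardPartition

variable {r k : ℕ} [Fact r.Prime] (e : Module.Basis (Fin k) (ZMod r) (Fin k → ZMod r))

lemma mem_stdOmega₂ {w : Fin k → ZMod r} : w ∈ stdOmega₂ e ↔
    (∃ i : Fin k, 0 < i.val ∧ w = e i) ∨ ∃ i j : Fin k, i.val + 1 = j.val ∧ w = e i + e j := by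
  simp [stdOmega₂]

/-- The sum of the coordinates with respect to a basis. -/
def coordSum : (Fin k → ZMod r) →ₗ[ZMod r] ZMod r := e.constr (ZMod r) fun _ => 1

lemma coordSum_basis (i : Fin k) : coordSum e (e i) = 1 := by simp [coordSum]

lemma repr_basis_apply (i j : Fin k) : e.repr (e i) j = if i = j then 1 else 0 := by
  rw [Module.Basis.repr_self, Finsupp.single_apply]

lemma basis_notMem_stdOmega₂ (hk : 0 < k) : e ⟨0, hk⟩ ∉ stdOmega₂ e := by
  rw [mem_stdOmega₂]
  rintro (⟨i, hi, h⟩ | ⟨i, j, hij, h⟩)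
  · have := e.injective h
    rw [← this] at hi
    exact lt_irrefl _ hi
  · have := congrArg (coordSum e) h
    rw [map_add] at this
    simp [coordSum_basis] at this

/-- The neighbours of `e n` in `stdOmega₂ e` are the adjacent basis vectors. -/
lemma eq_of_add_mem_stdOmega₂ (hr : 3 ≤ r) {n : Fin k} {w : Fin k → ZMod r}
    (hw : w ∈ stdOmega₂ e) (hnw : e n + w ∈ stdOmega₂ e) :
    ∃ m : Fin k, w = e m ∧ (n.val + 1 = m.val ∨ m.val + 1 = n.val) := by
  have h1 : (1 : ZMod r) ≠ 0 := one_ne_zero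
  have h2 : (2 : ZMod r) ≠ 0 := by
    intro h
    have := (ZMod.natCast_eq_zero_iff 2 r).1 (by exact_mod_cast h)
    exact absurd (Nat.le_of_dvd (by norm_num) this) (by omega)
  rw [mem_stdOmega₂] at hw hnw
  -- Members of the set have coordinate sum `1` or `2`. Adding `e n` to a basis vector gives sum
  -- `2`, so the result is an adjacent pair; adding it to a pair gives `3`, which is neither `1` nor
  -- `2` modulo `r`.
  rcases hw with ⟨i, hi, rfl⟩ | ⟨i, j, hij, rfl⟩
  · rcases hnw with ⟨l, -, h⟩ | ⟨l, m, hlm, h⟩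
    · have := congrArg (coordSum e) h
      rw [map_add] at this
      simp [coordSum_basis] at this
    · refine ⟨i, rfl, ?_⟩
      have hl := congrArg (fun x => e.repr x l) h
      have hm := congrArg (fun x => e.repr x m) h
      have hne : l ≠ m := by rintro rfl; omega
      simp only [map_add, Finsupp.add_apply, repr_basis_apply, if_true, if_neg hne,
        if_neg hne.symm, add_zero, zero_add] at hl hm
      by_cases a : n = l <;> by_cases b : i = l <;> by_cases a' : n = m <;> by_cases b' : i = m <;>
        simp_all
  · exfalso
    rcases hnw with ⟨l, -, h⟩ | ⟨l, m, hlm, h⟩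
    · have := congrArg (coordSum e) h
      simp only [map_add, coordSum_basis] at this
      refine h2 ?_
      linear_combination this
    · have := congrArg (coordSum e) h
      simp only [map_add, coordSum_basis] at this
      refine h1 ?_
      linear_combination this

/-- An additive permutation that fixes the first basis vector and preserves `stdOmega₂ e` is the
identity. -/
lemma eq_id_of_stdOmega₂_invariant (hr : 3 ≤ r) (hk : 0 < k)
    (σ : (Fin k → ZMod r) ≃+ (Fin k → ZMod r)) (h0 : σ (e ⟨0, hk⟩) = e ⟨0, hk⟩)
    (hΩ : ∀ w ∈ stdOmega₂ e, σ w ∈ stdOmega₂ e) (w : Fin k → ZMod r) : σ w = w := by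
  have key : ∀ n (hn : n < k), σ (e ⟨n, hn⟩) = e ⟨n, hn⟩ := by
    intro n
    induction n using Nat.strong_induction_on with
    | _ n ih =>
      intro hn
      rcases n with _ | n
      · exact h0
      have hn' : n < k := by omega
      have hmem := hΩ _ ((mem_stdOmega₂ e).2 (Or.inl ⟨⟨n + 1, hn⟩, Nat.succ_pos n, rfl⟩))
      have hadd := hΩ _ ((mem_stdOmega₂ e).2 (Or.inr ⟨⟨n, hn'⟩, ⟨n + 1, hn⟩, rfl, rfl⟩))
      rw [map_add, ih n (Nat.lt_succ_self n) hn'] at hadd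
      -- The image of `e (n + 1)` is a neighbour of the fixed vector `e n`. The preceding neighbour,
      -- if any, is already fixed by induction, so injectivity leaves only `e (n + 1)`.
      obtain ⟨m, hm, h | h⟩ := eq_of_add_mem_stdOmega₂ e hr hmem hadd
      · rw [hm]; congr 1; exact Fin.ext h.symm
      · simp only at h
        have h2 := ih m.val (by omega) m.isLt
        have := e.injective (σ.injective (hm.trans h2.symm))
        have := congrArg Fin.val this
        simp only at this
        omega
  exact IsMonomialFrame.addEquiv_eq_of_basis e σ (fun i => key i.val i.isLt) w

lemma card_stdOmega₂_le : (stdOmega₂ e).card ≤ 2 * (k - 1) := by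
  classical
  let f : ℕ → Fin k → ZMod r := fun j => if h : j + 1 < k then e ⟨j + 1, h⟩ else 0
  let g : ℕ → Fin k → ZMod r := fun j =>
    if h : j + 1 < k then e ⟨j, by omega⟩ + e ⟨j + 1, h⟩ else 0
  have hsub : stdOmega₂ e ⊆
      (Finset.range (k - 1)).image f ∪ (Finset.range (k - 1)).image g := by
    intro w hw
    rw [Finset.mem_union, Finset.mem_image, Finset.mem_image]
    rcases (mem_stdOmega₂ e).1 hw with ⟨⟨i, hik⟩, hi, rfl⟩ | ⟨⟨i, hik⟩, ⟨j, hj⟩, hij, rfl⟩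
    · obtain ⟨i, rfl⟩ := Nat.exists_eq_succ_of_ne_zero (Nat.pos_iff_ne_zero.1 hi)
      exact Or.inl ⟨i, Finset.mem_range.2 (by omega), dif_pos hik⟩
    · simp only at hij
      subst hij
      exact Or.inr ⟨i, Finset.mem_range.2 (by omega), dif_pos hj⟩
  have h1 := Finset.card_le_card hsub
  have h2 := Finset.card_union_le ((Finset.range (k - 1)).image f)
    ((Finset.range (k - 1)).image g)
  have h3 := Finset.card_image_le (s := Finset.range (k - 1)) (f := f)
  have h4 := Finset.card_image_le (s := Finset.range (k - 1)) (f := g)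
  rw [Finset.card_range] at h3 h4
  omega

omit [Fact r.Prime] in
-- With at most `2 * (k - 1)` elements in the standard set, the condition `4 * (card + 2) < r ^ k`
-- reduces to this bound, which fails for `r ^ k = 9`.
lemma eight_mul_lt_pow (hr : r.Prime) (hr3 : 3 ≤ r) (hk : 2 ≤ k) (h9 : r ^ k ≠ 9) :
    8 * k < r ^ k := by
  rcases hr3.eq_or_lt with rfl | h
  · have hk3 : 3 ≤ k := by
      by_contra hlt
      exact h9 (by rw [show k = 2 by omega]; norm_num)
    clear h9 hk
    induction k, hk3 using Nat.le_induction with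
    | base => norm_num
    | succ k hk ih => rw [pow_succ]; omega
  · have hr4 : r ≠ 4 := by rintro rfl; revert hr; decide
    have hr5 : 5 ≤ r := by omega
    refine lt_of_lt_of_le ?_ (Nat.pow_le_pow_left hr5 k)
    clear h9
    induction k, hk using Nat.le_induction with
    | base => norm_num
    | succ k hk ih => rw [pow_succ]; omega

lemma card_stdOmega₂_lt (hr3 : 3 ≤ r) (hk : 2 ≤ k) (h9 : r ^ k ≠ 9) :
    4 * ((stdOmega₂ e).card + 2) < r ^ k := by
  have h1 := card_stdOmega₂_le e
  have h2 := eight_mul_lt_pow Fact.out hr3 hk h9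
  omega

end StandardPartition

/-! ### Regularity of the standard partition, and the orders nine and three -/

lemma zmod_three_ne : (0 : ZMod 3) ≠ 1 ∧ (2 : ZMod 3) ≠ 1 ∧ (2 : ZMod 3) ≠ 0 := by decide

lemma zmod_three_eq : (2 : ZMod 3) * 2 = 1 ∧ (3 : ZMod 3) = 0 ∧ ∀ y : ZMod 3, 2 * y + y = 0 := by
  decide

lemma zmod_three_cases : ∀ x : ZMod 3, x = 0 ∨ x = 1 ∨ x = 2 := by decide

lemma zmod_three_ne_neg : ∀ y : ZMod 3, y ≠ 0 → y ≠ -y := by decide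

namespace IsMonomialFrame

variable {K V : Type*} [Field K] [AddCommGroup V] [Module K V] [Module.Finite K V]
  {r k : ℕ} [Fact r.Prime] {G Z N D D₁ S : Subgroup (V ≃ₗ[K] V)}
  {u : Module.Basis (Fin k → ZMod r) K V}

/-- Members of `permPart G u` are additive by `exists_quadratic`, so the rigidity of `stdOmega₂ e`
under additive permutations applies. -/
lemma isRegularPartition_stdOmega₂ (h : IsMonomialFrame Z N D D₁ S u)
    (hG : IsOfSymplecticType G Z N r) (hZ : Z = scalarGroup K V) (hr : 3 ≤ r)
    (e : Module.Basis (Fin k) (ZMod r) (Fin k → ZMod r)) (hk : 0 < k) :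
    IsRegularPartition (permPart G u)
      ![{e ⟨0, hk⟩}, stdOmega₂ e, ({e ⟨0, hk⟩} ∪ stdOmega₂ e)ᶜ] := by
  have h12 : Disjoint {e ⟨0, hk⟩} (stdOmega₂ e) :=
    Finset.disjoint_singleton_left.2 (basis_notMem_stdOmega₂ e hk)
  have h3 : Disjoint ({e ⟨0, hk⟩} ∪ stdOmega₂ e) ({e ⟨0, hk⟩} ∪ stdOmega₂ e)ᶜ :=
    disjoint_compl_right
  have h13 := Disjoint.mono_left Finset.subset_union_left h3
  have h23 := Disjoint.mono_left Finset.subset_union_right h3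
  refine ⟨?_, ?_, ?_⟩
  · intro i j hij
    fin_cases i <;> fin_cases j <;> first | exact absurd rfl hij | skip
    exacts [h12, h13, h12.symm, h23, h13.symm, h23.symm]
  · intro w
    by_cases h0 : w = e ⟨0, hk⟩
    · exact ⟨0, by simp [h0]⟩
    by_cases h2 : w ∈ stdOmega₂ e
    · exact ⟨1, h2⟩
    · exact ⟨2, by simp [h0, h2]⟩
  · rintro σ ⟨g, hg, hg0, hgσ⟩ hP
    obtain ⟨τ, c, -, hgu⟩ := h.exists_quadratic hG hZ hg hg0
    have hστ : ∀ w, σ w = τ w := by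
      intro w
      obtain ⟨b, hb⟩ := hgσ w
      exact label_inj u b.ne_zero (hb.symm.trans (hgu w))
    have h0 : τ (e ⟨0, hk⟩) = e ⟨0, hk⟩ := by
      have := hP 0
      simpa [hστ] using this
    have h2 : ∀ w ∈ stdOmega₂ e, τ w ∈ stdOmega₂ e := by
      intro w hw
      have := (hP 1).subset (Set.mem_image_of_mem σ hw)
      rwa [hστ] at this
    ext1 w
    rw [hστ, eq_id_of_stdOmega₂_invariant e hr hk τ h0 h2]
    rfl

/-- The base in the case `|W| = 9`. -/
lemma isBasePair_card_nine [Finite K] (h : IsMonomialFrame Z N D D₁ S u)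
    (hn : 1 < Module.finrank K V) (hcop : (Nat.card G).Coprime (Nat.card V))
    (hG : IsOfSymplecticType G Z N r) (hZ : Z = scalarGroup K V) (hr : 3 ≤ r)
    (e : Module.Basis (Fin k) (ZMod r) (Fin k → ZMod r)) (hk : 0 < k) (hk2 : 1 < k)
    (h9 : r ^ k = 9) {α : Kˣ} (hα : ∀ β : Kˣ, β ∈ Subgroup.zpowers α) :
    IsBasePair G (u 0) ((α : K) • u (e ⟨0, hk⟩) + (0 : K) • u (e ⟨1, hk2⟩) +
      ∑ w ∈ ({e ⟨0, hk⟩, e ⟨1, hk2⟩} : Finset (Fin k → ZMod r))ᶜ, u w) := by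
  have hr3 : r = 3 := by
    by_contra hne
    have : 4 ^ 2 ≤ r ^ k :=
      (Nat.pow_le_pow_left (by omega) 2).trans (Nat.pow_le_pow_right (by omega) hk2)
    omega
  subst hr3
  have hk' : k = 2 := Nat.pow_right_injective (le_refl 2 |>.trans (by norm_num : 2 ≤ 3)) (by
    simpa using h9)
  subst hk'
  obtain ⟨z01, z21, z20⟩ := zmod_three_ne
  obtain ⟨z22, z3, zy⟩ := zmod_three_eq
  set a := e ⟨0, hk⟩ with ha
  set b := e ⟨1, hk2⟩ with hb
  have hrepr : ∀ w, w = e.repr w 0 • a + e.repr w 1 • b := by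
    intro w
    conv_lhs => rw [← e.sum_repr w, Fin.sum_univ_two]
    rfl
  have hlin : ∀ {x y x' y' : ZMod 3}, x • a + y • b = x' • a + y' • b → x = x' ∧ y = y' := by
    intro x y x' y' hxy
    have h0 := congrArg (fun w => e.repr w 0) hxy
    have h1 := congrArg (fun w => e.repr w 1) hxy
    simp [ha, hb] at h0 h1
    exact ⟨h0, h1⟩
  have hα1 : α ≠ 1 := h.generator_ne_one hG hZ (e.ne_zero ⟨0, hk⟩) hα
  have hab : a ≠ b := fun hab => by
    have := hlin (x := 1) (y := 0) (x' := 0) (y' := 1) (by simpa using hab)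
    exact z01 this.1.symm
  refine h.isBasePair hG hZ fun g hg σ c hc hgu hY => ?_
  have hrep : ∀ w, u.repr ((α : K) • u a + (0 : K) • u b +
      ∑ w ∈ ({a, b} : Finset (Fin 2 → ZMod 3))ᶜ, u w) w =
      if w = a then (α : K) else if w = b then 0 else 1 := by
    intro w
    by_cases h1 : w = a
    · subst h1; simp [Finsupp.single_apply]
    · by_cases h2 : w = b
      · subst h2; simp [Finsupp.single_apply, h1, Ne.symm h1]
      · simp [Finsupp.single_apply, h1, h2]
  simp only [hrep] at hY
  have hσb : σ b = b := by
    have := hY b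
    rw [if_neg hab.symm, if_pos rfl, mul_zero] at this
    by_contra hne
    split_ifs at this <;> simp at this
  have hcw : ∀ w, w ≠ a → w ≠ b → σ w ≠ a → c w = 1 := by
    intro w h1 h2 h3
    have h4 : σ w ≠ b := fun h4 => h2 (σ.injective (h4.trans hσb.symm))
    have := hY w
    rw [if_neg h1, if_neg h2, if_neg h3, if_neg h4, mul_one] at this
    exact Units.ext this.symm
  by_cases hσa : σ a = a
  · have hσ : ∀ w, σ w = w := addEquiv_eq_of_basis e σ (fun i => by
      fin_cases i
      · exact hσa
      · exact hσb)
    refine ⟨hσ, hc.eq_one_of_small_support {b} (by simp) ?_⟩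
    intro w hw
    rw [Finset.mem_singleton] at hw
    by_cases hwa : w = a
    · subst hwa
      have := hY a
      rw [hσa, if_pos rfl] at this
      exact Units.ext ((mul_eq_right₀ α.ne_zero).1 this.symm)
    · exact hcw w hwa hw (by rwa [hσ])
  · exfalso
    obtain ⟨f, hf⟩ := σ.surjective a
    have hfa : f ≠ a := by rintro rfl; exact hσa hf
    have hfb : f ≠ b := by rintro rfl; exact hab (hf.symm.trans hσb)
    have hcf : c f = α := by
      have := hY f
      rw [hf, if_pos rfl, if_neg hfa, if_neg hfb, mul_one] at this
      exact Units.ext this.symm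
    -- As a value of `c`, `α` satisfies `α ^ 3 = 1`. Hence `|Kˣ|` is odd, `|V|` is even, and `|G|`
    -- is odd by coprimality.
    have hpow := hc.pow_eq_one (r := 3) (by norm_num) le_rfl nsmul_eq_zero_zmod
    have hα3 : α ^ 3 = 1 := hcf ▸ hpow f
    have hodd : Odd (Nat.card G) := by
      have hev := even_card_of_generator_pow_eq_one hn (by decide : Odd 3) hα hα3
      rw [← Nat.not_even_iff_odd]
      intro hev2
      have := Nat.dvd_gcd hev2.two_dvd hev.two_dvd
      rw [hcop] at this
      norm_num at this
    have hsmul : ∀ (x : ZMod 3) w, σ (x • w) = x • σ w := fun x w =>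
      map_smul (AddMonoidHom.toZModLinearMap 3 σ.toAddMonoidHom) x w
    obtain ⟨x, y, hxy⟩ : ∃ x y : ZMod 3, σ a = x • a + y • b := ⟨_, _, hrepr _⟩
    -- For `x = 0` injectivity fails, and for `x = 2` the map `σ` is an involution moving `a`,
    -- excluded by odd order. So `σ a = a + y b` with `y ≠ 0`, and `f = a - y b`.
    have hx : x = 1 := by
      rcases zmod_three_cases x with rfl | hx | rfl
      · exfalso
        have : σ a = σ (y • b) := by rw [hsmul, hσb, hxy, zero_smul, zero_add]
        have h1 := hlin (x := 1) (y := 0) (x' := 0) (y' := y) (by simpa using σ.injective this)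
        exact z01 h1.1.symm
      · exact hx
      · exfalso
        have hinv : ∀ w, (σ.trans σ) w = w := addEquiv_eq_of_basis e _ (fun i => by
          fin_cases i
          · change σ (σ a) = a
            rw [hxy, map_add, hsmul, hsmul, hσb, hxy, smul_add, smul_smul, smul_smul, add_assoc,
              ← add_smul, z22, zy, one_smul, zero_smul, add_zero]
          · change σ (σ b) = b
            rw [hσb, hσb])
        exact hσa (perm_eq_of_odd_card hodd u hg hgu hinv a)
    subst hx
    rw [one_smul] at hxy
    have hy0 : y ≠ 0 := by
      rintro rfl
      exact hσa (by rw [hxy, zero_smul, add_zero])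
    have hff : f = (1 : ZMod 3) • a + (-y) • b := by
      refine σ.injective ?_
      rw [hf, map_add, hsmul, hsmul, hσb, hxy, smul_add, one_smul, one_smul, add_assoc,
        ← add_smul, add_neg_cancel, zero_smul, add_zero]
    -- These are all the points other than `a`, `b` and `f`. Two cube identities extend the value
    -- `1` to `b` and then to `a`; but `σ a` has coordinate `1` and `a` has coordinate `α`, so `c a
    -- = 1` forces `α = 1`.
    have hc1 : ∀ x z : ZMod 3, (x = 0 ∧ z ≠ 1) ∨ x = 2 ∨ (x = 1 ∧ z = y) →
        c (x • a + z • b) = 1 := by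
      intro x z hxz
      refine hcw _ (fun hh => ?_) (fun hh => ?_) (fun hh => ?_)
      · obtain ⟨h1, h2⟩ := hlin (x' := 1) (y' := 0) (by simpa using hh)
        rcases hxz with h | h | h
        · exact z01 (h.1.symm.trans h1)
        · exact z21 (h.symm.trans h1)
        · exact hy0 (h.2.symm.trans h2)
      · obtain ⟨h1, h2⟩ := hlin (x' := 0) (y' := 1) (by simpa using hh)
        rcases hxz with h | h | h
        · exact h.2 h2
        · exact z20 (h.symm.trans h1)
        · exact z01 (h.1.symm.trans h1).symm
      · obtain ⟨h1, h2⟩ := hlin ((σ.injective (hh.trans hf.symm)).trans hff)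
        rcases hxz with h | h | h
        · exact z01 (h.1.symm.trans h1)
        · exact z21 (h.symm.trans h1)
        · exact zmod_three_ne_neg y hy0 (h.2.symm.trans h2)
    have hcb : c b = 1 := by
      have q := hc.cube ((2 : ZMod 3) • a + (0 : ZMod 3) • b) b b
      have e1 : (2 : ZMod 3) • a + (0 : ZMod 3) • b + b + b =
          (2 : ZMod 3) • a + (2 : ZMod 3) • b := by module
      have e2 : (2 : ZMod 3) • a + (0 : ZMod 3) • b + b =
          (2 : ZMod 3) • a + (1 : ZMod 3) • b := by module
      have e3 : b + b = (0 : ZMod 3) • a + (2 : ZMod 3) • b := by module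
      rw [e1, e2, e3, hc1 2 2 (by simp), hc1 2 0 (by simp), hc1 2 1 (by simp),
        hc1 0 2 (Or.inl ⟨rfl, z21⟩)] at q
      simp only [one_mul, mul_one] at q
      have h3 := hpow b
      rwa [pow_succ, pow_two, q, one_mul] at h3
    have hcF : c (y • b) = 1 := by
      have hy3 : y = 1 ∨ y ≠ 1 := eq_or_ne y 1
      rcases hy3 with rfl | hy
      · rwa [one_smul]
      · have := hc1 0 y (Or.inl ⟨rfl, hy⟩)
        rwa [zero_smul, zero_add] at this
    have q := hc.cube a ((2 : ZMod 3) • a) (y • b)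
    have e3 : a + (2 : ZMod 3) • a = 0 := by
      have : a + (2 : ZMod 3) • a = (3 : ZMod 3) • a := by module
      rw [this, z3, zero_smul]
    have h2a : c ((2 : ZMod 3) • a) = 1 := by
      simpa using hc1 2 0 (by simp)
    have hay : c (a + y • b) = 1 := by
      simpa using hc1 1 y (by simp)
    rw [e3, zero_add, hcF, hc.map_zero, h2a, hay, hc1 2 y (by simp)] at q
    simp only [one_mul, mul_one] at q
    have := hY a
    have hne : σ a ≠ b := fun hh => hab (σ.injective (hh.trans hσb.symm))
    rw [if_neg hσa, if_pos rfl, if_neg hne, q, Units.val_one, one_mul] at this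
    exact hα1 (Units.ext this.symm)

/-- The base in the case `|W| = 3`. -/
lemma isBasePair_card_three [Finite K] (h : IsMonomialFrame Z N D D₁ S u)
    (hn : 1 < Module.finrank K V) (hcop : (Nat.card G).Coprime (Nat.card V))
    (hG : IsOfSymplecticType G Z N r) (hZ : Z = scalarGroup K V) (hr : 3 ≤ r)
    (h3 : r ^ k = 3) {α : Kˣ} (hα : ∀ β : Kˣ, β ∈ Subgroup.zpowers α)
    {v w : Fin k → ZMod r} (hv : v ≠ 0) (hw : w ≠ 0) (hvw : v ≠ w) :
    IsBasePair G (u 0) ((α : K) • u v + u w) := by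
  have hcW : Fintype.card (Fin k → ZMod r) = 3 := by simp [ZMod.card, h3]
  have hall : ∀ x, x = 0 ∨ x = v ∨ x = w := by
    have hc3 : ({0, v, w} : Finset (Fin k → ZMod r)).card = 3 := by
      rw [Finset.card_eq_three]
      exact ⟨0, v, w, hv.symm, hw.symm, hvw, rfl⟩
    have := Finset.eq_univ_of_card _ (hc3.trans hcW.symm)
    intro x
    have hx := Finset.mem_univ x
    rw [← this] at hx
    simpa using hx
  refine h.isBasePair hG hZ fun g hg σ c hc hgu hY => ?_
  have hYv : u.repr ((α : K) • u v + u w) v = α := by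
    simp [hvw.symm]
  have hYw : u.repr ((α : K) • u v + u w) w = 1 := by
    simp [hvw]
  have hσ0 : ∀ x, x ≠ 0 → σ x ≠ 0 := fun x hx => by simpa using hx
  rcases (hall (σ v)).resolve_left (hσ0 v hv) with hσv | hσv
  · have hσw : σ w = w := by
      refine ((hall (σ w)).resolve_left (hσ0 w hw)).resolve_left fun hh => ?_
      exact hvw (σ.injective (hσv.trans hh.symm))
    have hcv : c v = 1 := by
      have := hY v
      rw [hσv, hYv] at this
      exact Units.ext ((mul_eq_right₀ α.ne_zero).1 this.symm)
    have hcw : c w = 1 := by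
      have := hY w
      rw [hσw, hYw, mul_one] at this
      exact Units.ext this.symm
    constructor <;> intro x <;> rcases hall x with rfl | rfl | rfl
    exacts [map_zero σ, hσv, hσw, hc.map_zero, hcv, hcw]
  -- If `σ` swaps `v` and `w`, then `α = c w` has `r`-th power `1`, so `|G|` is odd, while `σ` is a
  -- nontrivial involution.
  · exfalso
    have hσw : σ w = v := by
      refine ((hall (σ w)).resolve_left (hσ0 w hw)).resolve_right fun hh => ?_
      exact hvw (σ.injective (hσv.trans hh.symm))
    have hcw : c w = α := by
      have := hY w
      rw [hσw, hYw, hYv, mul_one] at this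
      exact Units.ext this.symm
    have hp : r.Prime := Fact.out
    have hαr : α ^ r = 1 := hcw ▸ hc.pow_eq_one hp hr nsmul_eq_zero_zmod w
    have hodd : Odd (Nat.card G) := by
      have hev := even_card_of_generator_pow_eq_one hn (hp.odd_of_ne_two (by omega)) hα hαr
      rw [← Nat.not_even_iff_odd]
      intro hev2
      have := Nat.dvd_gcd hev2.two_dvd hev.two_dvd
      rw [hcop] at this
      norm_num at this
    have hinv : ∀ x, σ (σ x) = x := by
      intro x
      rcases hall x with rfl | rfl | rfl
      · rw [map_zero, map_zero]
      · rw [hσv, hσw]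
      · rw [hσw, hσv]
    exact hvw ((perm_eq_of_odd_card hodd u hg hgu hinv v).symm.trans hσv)

end IsMonomialFrame

/-! ### The commutator pairing and complementary abelian subgroups -/

section ClassTwo

variable {N : Type*} [Group N]

lemma commutatorElement_mul_right_of_central (hN : ∀ x y : N, ⁅x, y⁆ ∈ Subgroup.center N)
    (z x y : N) : ⁅z, x * y⁆ = ⁅z, x⁆ * ⁅z, y⁆ := by
  rw [commutatorElement_mul_right_eq_mul_conj]
  have := Subgroup.mem_center_iff.1 (hN z y) x
  rw [mul_assoc ⁅z, x⁆, this]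
  group

lemma commutatorElement_mul_left_of_central (hN : ∀ x y : N, ⁅x, y⁆ ∈ Subgroup.center N)
    (x y z : N) : ⁅x * y, z⁆ = ⁅x, z⁆ * ⁅y, z⁆ := by
  rw [← commutatorElement_inv, commutatorElement_mul_right_of_central hN, mul_inv_rev,
    commutatorElement_inv, commutatorElement_inv]
  exact (Subgroup.mem_center_iff.1 (hN x z) _)

/-- The power formula in a group of nilpotency class two. -/
lemma mul_pow_of_central_commutator {x y z : N} (hz : z ∈ Subgroup.center N)
    (hxy : y * x = x * y * z) (n : ℕ) : (x * y) ^ n = x ^ n * y ^ n * z ^ n.choose 2 := by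
  have hzc : ∀ (j : ℕ) (w : N), z ^ j * w = w * z ^ j := fun j w =>
    (Subgroup.mem_center_iff.1 (Subgroup.pow_mem _ hz j) w).symm
  have hyx : ∀ n : ℕ, y ^ n * x = x * y ^ n * z ^ n := by
    intro n
    induction n with
    | zero => simp
    | succ n ih =>
      rw [pow_succ', mul_assoc, ih, ← mul_assoc, ← mul_assoc, hxy, pow_succ' z, ← mul_assoc,
        mul_assoc (x * y) z, ← pow_one z, hzc, pow_one]
      simp only [mul_assoc]
  induction n with
  | zero => simp
  | succ n ih =>
    rw [pow_succ, ih, Nat.choose_succ_succ' n 1, Nat.choose_one_right, pow_add z, mul_assoc, hzc,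
      ← mul_assoc (x ^ n * y ^ n), mul_assoc (x ^ n), ← mul_assoc (y ^ n), hyx,
      mul_assoc (x * y ^ n), hzc]
    simp only [pow_succ, mul_assoc, Nat.reduceAdd]

variable {K : Type*} [Field K]

/-- In a group of class two whose centre embeds in `Kˣ`, every element outside a subgroup `X` that
contains the centre is detected by the commutator with some element that centralises `X`. -/
lemma exists_mem_centralizer_not_commute [Finite N] {r : ℕ} (hr : r.Prime)
    (hN : ∀ x y : N, ⁅x, y⁆ ∈ Subgroup.center N) (hpow : ∀ x : N, x ^ r ∈ Subgroup.center N)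
    (κ : Subgroup.center N →* Kˣ) (hκ : Function.Injective κ) {ω : K} (hω : IsPrimitiveRoot ω r)
    (X : Subgroup N) (hX : Subgroup.center N ≤ X) {y : N} (hy : y ∉ X) :
    ∃ z ∈ Subgroup.centralizer (X : Set N), z * y ≠ y * z := by
  let Q := N ⧸ Subgroup.center N
  let _ : CommGroup Q :=
    { (inferInstance : Group Q) with
      mul_comm := by
        rintro ⟨a⟩ ⟨b⟩
        refine QuotientGroup.eq.2 ?_
        have : (a * b)⁻¹ * (b * a) = ⁅b⁻¹, a⁻¹⁆ := by rw [commutatorElement_def]; group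
        rw [this]
        exact hN _ _ }
  have : NeZero r := ⟨hr.ne_zero⟩
  have : HasEnoughRootsOfUnity K r := ⟨⟨ω, hω⟩, inferInstance⟩
  have : HasEnoughRootsOfUnity K (Monoid.exponent Q) := by
    refine HasEnoughRootsOfUnity.of_dvd K (n := r) (Monoid.exponent_dvd_of_forall_pow_eq_one ?_)
    rintro ⟨a⟩
    exact (QuotientGroup.eq_one_iff (a ^ r)).2 (hpow a)
  let β : N →* N →* Kˣ :=
    MonoidHom.mk' (fun z => MonoidHom.mk' (fun x => κ ⟨⁅z, x⁆, hN z x⟩) fun x x' => by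
      rw [← map_mul]
      congr 1
      exact Subtype.ext (commutatorElement_mul_right_of_central hN z x x')) fun z z' => by
      ext1 x
      simp only [MonoidHom.mk'_apply, MonoidHom.mul_apply]
      rw [← map_mul]
      congr 1
      exact Subtype.ext (commutatorElement_mul_left_of_central hN z z' x)
  have hβ : ∀ z x, β z x = 1 ↔ z * x = x * z := by
    intro z x
    change κ ⟨⁅z, x⁆, hN z x⟩ = 1 ↔ _
    rw [map_eq_one_iff κ hκ, Subtype.ext_iff]
    exact commutatorElement_eq_one_iff_mul_comm
  have hker : ∀ z, Subgroup.center N ≤ (β z).ker := fun z x hx =>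
    (hβ z x).2 (Subgroup.mem_center_iff.1 hx z)
  let P : N →* Q →* Kˣ :=
    MonoidHom.mk' (fun z => QuotientGroup.lift _ (β z) (hker z)) fun z z' => by
      refine QuotientGroup.monoidHom_ext _ (MonoidHom.ext fun x => ?_)
      change β (z * z') x = β z x * β z' x
      rw [map_mul]; rfl
  have hP : ∀ z x, P z (QuotientGroup.mk x) = β z x := fun z x => rfl
  have hPker : Subgroup.center N ≤ P.ker := by
    intro z hz
    rw [MonoidHom.mem_ker]
    refine QuotientGroup.monoidHom_ext _ (MonoidHom.ext fun x => ?_)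
    exact (hβ z x).2 (Subgroup.mem_center_iff.1 hz x).symm
  have hinj : Function.Injective (QuotientGroup.lift _ P hPker) := by
    rw [injective_iff_map_eq_one]
    rintro ⟨z⟩ hz
    refine (QuotientGroup.eq_one_iff z).2 (Subgroup.mem_center_iff.2 fun x => ?_)
    exact ((hβ z x).1 (DFunLike.congr_fun hz (QuotientGroup.mk x))).symm
  -- The pairing embeds `Q` in its dual, which has the same order, so every character of `Q` is a
  -- commutator with some `z`. Applied to a character trivial on `X` but not at `y`, this gives the
  -- required element.
  have hcard := CommGroup.card_monoidHom_of_hasEnoughRootsOfUnity Q K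
  have : Finite (Q →* Kˣ) := Nat.finite_of_card_ne_zero (by rw [hcard]; exact Nat.card_pos.ne')
  have hsurj := (hinj.bijective_of_nat_card_le hcard.le).2
  have hyX : (QuotientGroup.mk y : Q) ∉ X.map (QuotientGroup.mk' (Subgroup.center N)) := by
    rintro ⟨x, hx, hxy⟩
    have := hX (QuotientGroup.eq.1 hxy)
    exact hy (by simpa using X.mul_mem hx this)
  rw [← CommGroup.forall_monoidHom_apply_eq_one_iff K] at hyX
  push Not at hyX
  obtain ⟨φ, hφX, hφy⟩ := hyX
  obtain ⟨⟨z⟩, rfl⟩ := hsurj φ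
  refine ⟨z, Subgroup.mem_centralizer_iff.2 fun x hx => ?_, fun h => hφy ((hβ z y).2 h)⟩
  exact ((hβ z x).1 (hφX _ ⟨x, hx, rfl⟩)).symm

lemma sup_zpowers_le_centralizer {X : Subgroup N}
    (hX : X ≤ Subgroup.centralizer (X : Set N)) {t : N}
    (ht : t ∈ Subgroup.centralizer (X : Set N)) :
    X ⊔ Subgroup.zpowers t ≤
      Subgroup.centralizer ((X ⊔ Subgroup.zpowers t : Subgroup N) : Set N) := by
  have htt : Subgroup.zpowers t ≤ Subgroup.centralizer (Subgroup.zpowers t : Set N) := by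
    rw [Subgroup.le_centralizer_iff_isMulCommutative]; infer_instance
  have htX : Subgroup.zpowers t ≤ Subgroup.centralizer (X : Set N) := by
    rwa [Subgroup.zpowers_le]
  refine sup_le ?_ ?_ <;> rw [Subgroup.le_centralizer_iff] <;> refine sup_le ?_ ?_
  · exact hX
  · exact htX
  · exact Subgroup.le_centralizer_iff.1 htX
  · exact htt

/-- A class two group in which subgroups above the centre are double centralisers has two
complementary maximal abelian subgroups. -/
lemma exists_complementary_abelian [Finite N] {r : ℕ} (hr : r.Prime)
    (hN : ∀ x y : N, ⁅x, y⁆ ∈ Subgroup.center N) (hpow : ∀ x : N, x ^ r ∈ Subgroup.center N)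
    (hsep : ∀ X : Subgroup N, Subgroup.center N ≤ X → ∀ y ∉ X,
      ∃ z ∈ Subgroup.centralizer (X : Set N), z * y ≠ y * z) :
    ∃ D S : Subgroup N, Subgroup.center N ≤ D ∧ Subgroup.center N ≤ S ∧
      Subgroup.centralizer (D : Set N) = D ∧ S ≤ Subgroup.centralizer (S : Set N) ∧
      D ⊓ S = Subgroup.center N ∧ D ⊔ S = ⊤ := by
  have hcc : Subgroup.center N ≤ Subgroup.centralizer (Subgroup.center N : Set N) :=
    Subgroup.center_le_centralizer _
  obtain ⟨D, -, ⟨hZD, hDD⟩, hDmax⟩ := (Set.toFinite {X : Subgroup N | Subgroup.center N ≤ X ∧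
    X ≤ Subgroup.centralizer (X : Set N)}).exists_le_maximal
      (a := Subgroup.center N) ⟨le_rfl, hcc⟩
  have hDc : Subgroup.centralizer (D : Set N) = D := by
    refine le_antisymm (fun t ht => ?_) hDD
    exact hDmax ⟨hZD.trans le_sup_left, sup_zpowers_le_centralizer hDD ht⟩ le_sup_left
      (Subgroup.mem_sup_right (Subgroup.mem_zpowers t))
  obtain ⟨S, -, ⟨hZS, hSS, hDS⟩, hSmax⟩ := (Set.toFinite {X : Subgroup N |
    Subgroup.center N ≤ X ∧ X ≤ Subgroup.centralizer (X : Set N) ∧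
      D ⊓ X = Subgroup.center N}).exists_le_maximal
        (a := Subgroup.center N) ⟨le_rfl, hcc, inf_eq_right.2 hZD⟩
  -- Otherwise adjoin such a `t` to `S`. If `s * t ^ j ∈ D`, then `t ^ j ∈ D ⊔ S`; as `t ^ r` is
  -- central and `t ∉ D ⊔ S`, `r` divides `j`. Hence `s * t ^ j` already lies in `S`, contradicting
  -- maximality.
  have hSc : Subgroup.centralizer (S : Set N) ≤ D ⊔ S := by
    intro t ht
    by_contra htX
    have hSn : S.Normal := ⟨fun s hs g => by
      have : g * s * g⁻¹ = ⁅g, s⁆ * s := by rw [commutatorElement_def]; group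
      rw [this]
      exact S.mul_mem (hZS (hN g s)) hs⟩
    refine htX (Subgroup.mem_sup_right (hSmax (y := S ⊔ Subgroup.zpowers t)
      ⟨hZS.trans le_sup_left, sup_zpowers_le_centralizer hSS ht,
      le_antisymm ?_ (le_inf hZD (hZS.trans le_sup_left))⟩ le_sup_left
      (Subgroup.mem_sup_right (Subgroup.mem_zpowers t))))
    rintro d ⟨hd, hd'⟩
    obtain ⟨s, hs, _, ⟨j, rfl⟩, rfl⟩ := Subgroup.mem_sup_of_normal_left.1 hd'
    simp only at hd
    have htj : t ^ j ∈ D ⊔ S := by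
      have : t ^ j = s⁻¹ * (s * t ^ j) := by group
      rw [this]
      exact mul_mem (Subgroup.mem_sup_right (S.inv_mem hs)) (Subgroup.mem_sup_left hd)
    have htr : t ^ r ∈ Subgroup.center N := hpow t
    by_cases hrj : (r : ℤ) ∣ j
    · obtain ⟨m, rfl⟩ := hrj
      rw [← hDS]
      refine ⟨hd, S.mul_mem hs (hZS ?_)⟩
      simp only
      rw [zpow_mul, zpow_natCast]
      exact Subgroup.zpow_mem _ htr m
    · exfalso
      obtain ⟨a, b, hab⟩ := (Nat.prime_iff_prime_int.1 hr).coprime_iff_not_dvd.2 hrj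
      apply htX
      have : t = (t ^ r) ^ a * (t ^ j) ^ b := by
        rw [← zpow_natCast, ← zpow_mul, ← zpow_mul, ← zpow_add, mul_comm (r : ℤ), mul_comm j, hab,
          zpow_one]
      rw [this]
      exact mul_mem (Subgroup.mem_sup_left (hZD (Subgroup.zpow_mem _ htr a)))
        (Subgroup.zpow_mem _ htj b)
  refine ⟨D, S, hZD, hZS, hDc, hSS, hDS, ?_⟩
  by_contra htop
  obtain ⟨y, hy⟩ : ∃ y, y ∉ D ⊔ S := by
    by_contra! h
    exact htop (eq_top_iff.2 fun y _ => h y)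
  -- Here `z` centralises `D ⊔ S`, so it lies in `D`, but it is not central and so not in `S`.
  -- Separation from `S` gives `t` centralising `S` but not commuting with `z`, although `t ∈ D ⊔
  -- S`.
  obtain ⟨z, hz, hzy⟩ := hsep _ (hZD.trans le_sup_left) y hy
  have hzD : z ∈ D := hDc ▸ Subgroup.centralizer_le (SetLike.coe_subset_coe.2 le_sup_left) hz
  have hzS : z ∉ S := by
    intro hzS
    have : z ∈ Subgroup.center N := hDS ▸ ⟨hzD, hzS⟩
    exact hzy (Subgroup.mem_center_iff.1 this y).symm
  obtain ⟨t, ht, htz⟩ := hsep S hZS z hzS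
  exact htz (Subgroup.mem_centralizer_iff.1 hz t (hSc ht))

end ClassTwo

/-! ### Eigenvectors, roots of unity and the effect of chiefness -/

section Existence

variable {K V : Type*} [Field K] [AddCommGroup V] [Module K V]

variable (K V) in
/-- The scalar transformations as a homomorphism. -/
def scalarHom : Kˣ →* (V ≃ₗ[K] V) := DistribMulAction.toModuleAut K V

@[simp]
lemma scalarHom_apply (c : Kˣ) (v : V) : scalarHom K V c v = (c : K) • v := rfl

lemma mem_scalarGroup_iff {g : V ≃ₗ[K] V} : g ∈ scalarGroup K V ↔ ∃ c, g = scalarHom K V c :=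
  exists_congr fun _ => ⟨fun h => LinearEquiv.ext h, fun h v => by rw [h, scalarHom_apply]⟩

lemma scalarHom_mem_center (c : Kˣ) : scalarHom K V c ∈ Subgroup.center (V ≃ₗ[K] V) :=
  Subgroup.mem_center_iff.2 fun g => LinearEquiv.ext fun v => by simp

lemma scalarHom_injective [Nontrivial V] : Function.Injective (scalarHom K V) := by
  intro a b hab
  obtain ⟨v, hv⟩ := exists_ne (0 : V)
  have := DFunLike.congr_fun hab v
  rw [scalarHom_apply, scalarHom_apply] at this
  exact Units.ext (smul_left_injective K hv this)

/-- A finite commuting family of transformations whose `r`-th powers are `r`-th powers of scalars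
has a common eigenvector if `K` contains the `r`-th roots of unity. -/
lemma exists_common_eigenvector [Module.Finite K V] [Nontrivial V] {r : ℕ} (hr : 0 < r) {ω : K}
    (hω : IsPrimitiveRoot ω r) {A : Subgroup (V ≃ₗ[K] V)}
    (hA : A ≤ Subgroup.centralizer (A : Set (V ≃ₗ[K] V)))
    (hpow : ∀ x ∈ A, ∃ c, x ^ r = scalarHom K V c ^ r) :
    ∃ v : V, v ≠ 0 ∧ ∀ x ∈ A, ∃ c : Kˣ, x v = (c : K) • v := by
  obtain ⟨U, ⟨hU0, hUA⟩, hUmin⟩ := wellFounded_lt.has_min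
    {U : Submodule K V | U ≠ ⊥ ∧ ∀ x ∈ A, ∀ v ∈ U, x v ∈ U} ⟨⊤, top_ne_bot, by simp⟩
  -- On the minimal invariant subspace `U`, `x` is a root of `X ^ r - c ^ r`, which splits because
  -- `ω` is in `K`. An eigenspace of `x` in `U` is invariant under the commuting `A`, so it is all
  -- of `U`.
  have key : ∀ x ∈ A, ∃ c : K, ∀ v ∈ U, x v = c • v := by
    intro x hx
    obtain ⟨c, hc⟩ := hpow x hx
    have : Nontrivial U := Submodule.nontrivial_iff_ne_bot.2 hU0
    let f : Module.End K U := (x : V →ₗ[K] V).restrict (hUA x hx)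
    have hf : f ^ r = algebraMap K (Module.End K U) ((c : K) ^ r) := by
      ext v
      have h1 : ∀ n : ℕ, (((f ^ n) v : U) : V) = (x ^ n) v := by
        intro n
        induction n with
        | zero => rfl
        | succ n ih =>
          rw [pow_succ', pow_succ', Module.End.mul_apply, LinearEquiv.mul_apply, ← ih]
          rfl
      rw [h1, hc, ← map_pow, scalarHom_apply, Module.algebraMap_end_apply]
      simp
    have hdvd : minpoly K f ∣ Polynomial.X ^ r - Polynomial.C ((c : K) ^ r) := by
      apply minpoly.dvd
      simp [hf]
    have hsp : (Polynomial.X ^ r - Polynomial.C ((c : K) ^ r)).Splits :=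
      X_pow_sub_C_splits_of_isPrimitiveRoot hω rfl
    have hne : (Polynomial.X ^ r - Polynomial.C ((c : K) ^ r)) ≠ 0 :=
      Polynomial.X_pow_sub_C_ne_zero hr _
    have hsp' := hsp.of_dvd hne hdvd
    obtain ⟨μ, hμ⟩ := hsp'.exists_eval_eq_zero
      (minpoly.degree_pos (Algebra.IsIntegral.isIntegral f)).ne'
    have heig := Module.End.hasEigenvalue_of_isRoot hμ
    obtain ⟨w, hw⟩ := heig.exists_hasEigenvector
    refine ⟨μ, ?_⟩
    let U' : Submodule K V := U ⊓ Module.End.eigenspace (x : V →ₗ[K] V) μ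
    have hU' : U' = U := by
      by_contra hne
      refine hUmin U' ⟨?_, ?_⟩ (lt_of_le_of_ne inf_le_left hne)
      · intro hbot
        have hmem : (w : V) ∈ U' :=
          ⟨w.2, Module.End.mem_eigenspace_iff.2 (congrArg Subtype.val hw.apply_eq_smul)⟩
        rw [hbot, Submodule.mem_bot] at hmem
        exact hw.2 (Subtype.ext hmem)
      · rintro y hy v ⟨hv, hv'⟩
        refine ⟨hUA y hy v hv, Module.End.mem_eigenspace_iff.2 ?_⟩
        have hxy := Subgroup.mem_centralizer_iff.1 (hA hy) x hx
        have e := DFunLike.congr_fun hxy v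
        rw [LinearEquiv.mul_apply, LinearEquiv.mul_apply] at e
        have hv2 : x v = μ • v := Module.End.mem_eigenspace_iff.1 hv'
        rw [LinearEquiv.coe_coe, e, hv2, map_smul]
    intro v hv
    rw [← hU'] at hv
    exact Module.End.mem_eigenspace_iff.1 hv.2
  obtain ⟨v, hv, hv0⟩ := Submodule.exists_mem_ne_zero_of_ne_bot hU0
  refine ⟨v, hv0, fun x hx => ?_⟩
  obtain ⟨c, hc⟩ := key x hx
  have hc0 : c ≠ 0 := by
    rintro rfl
    have := hc v hv
    rw [zero_smul] at this
    exact hv0 (x.injective (by rw [this, map_zero]))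
  exact ⟨Units.mk0 c hc0, hc v hv⟩

/-- A group of transformations with an eigenvector `v` is the direct product of the scalars and
the stabiliser of `v`. -/
lemma sup_stabilizer_eq {A : Subgroup (V ≃ₗ[K] V)} (hA : scalarGroup K V ≤ A) {v : V}
    (hv : ∀ x ∈ A, ∃ c : Kˣ, x v = (c : K) • v) :
    scalarGroup K V ⊔ A ⊓ MulAction.stabilizer (V ≃ₗ[K] V) v = A := by
  refine le_antisymm (sup_le hA inf_le_left) fun x hx => ?_
  obtain ⟨c, hc⟩ := hv x hx
  have h1 : x = scalarHom K V c * (scalarHom K V c⁻¹ * x) := by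
    rw [← mul_assoc, ← map_mul, mul_inv_cancel, map_one, one_mul]
  have hm : ∀ c, scalarHom K V c ∈ scalarGroup K V := fun c => mem_scalarGroup_iff.2 ⟨c, rfl⟩
  rw [h1]
  refine mul_mem (Subgroup.mem_sup_left (hm c))
    (Subgroup.mem_sup_right ⟨mul_mem (hA (hm _)) hx, ?_⟩)
  change (scalarHom K V c⁻¹ * x) v = v
  rw [LinearEquiv.mul_apply, hc, scalarHom_apply, smul_smul, Units.inv_mul, one_smul]

lemma inf_stabilizer_eq_bot {v : V} (hv : v ≠ 0) (A : Subgroup (V ≃ₗ[K] V)) :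
    scalarGroup K V ⊓ (A ⊓ MulAction.stabilizer (V ≃ₗ[K] V) v) = ⊥ := by
  rw [eq_bot_iff]
  rintro x ⟨⟨c, hc⟩, -, hx⟩
  have h1 : x v = v := hx
  have : (c : K) = 1 := smul_left_injective K hv (by simp only; rw [← hc, h1, one_smul])
  rw [Subgroup.mem_bot]
  ext y
  rw [hc, this, one_smul, LinearEquiv.coe_one, id]

/-- A finite elementary abelian `r`-group is a power of `ZMod r`. -/
lemma exists_addEquiv_of_nsmul_eq_zero {A : Type*} [AddCommGroup A] [Finite A] (r : ℕ)
    [Fact r.Prime] (hA : ∀ a : A, r • a = 0) : ∃ k : ℕ, Nonempty ((Fin k → ZMod r) ≃+ A) := by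
  have : Module (ZMod r) A := AddCommGroup.zmodModule hA
  exact ⟨_, ⟨(Module.finBasis (ZMod r) A).equivFun.symm.toAddEquiv⟩⟩

lemma exists_mulEquiv_of_pow_eq_one {S : Type*} [CommGroup S] [Finite S] (r : ℕ) [Fact r.Prime]
    (hS : ∀ s : S, s ^ r = 1) : ∃ k : ℕ, Nonempty (Multiplicative (Fin k → ZMod r) ≃* S) := by
  obtain ⟨k, ⟨φ⟩⟩ := exists_addEquiv_of_nsmul_eq_zero (A := Additive S) r
    fun x => congrArg Additive.ofMul (hS x.toMul)
  exact ⟨k, ⟨AddEquiv.toMultiplicativeLeft φ⟩⟩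

variable {r : ℕ} {G Z N : Subgroup (V ≃ₗ[K] V)}

lemma mem_iff_of_eq_scalarGroup (hZ : Z = scalarGroup K V) {x : V ≃ₗ[K] V} :
    x ∈ Z ↔ ∃ c, x = scalarHom K V c := by
  rw [hZ, mem_scalarGroup_iff]

lemma commute_of_mem_scalarGroup (hZ : Z = scalarGroup K V) {x : V ≃ₗ[K] V} (hx : x ∈ Z)
    (y : V ≃ₗ[K] V) : y * x = x * y := by
  obtain ⟨c, rfl⟩ := (mem_iff_of_eq_scalarGroup hZ).1 hx
  exact Subgroup.mem_center_iff.1 (scalarHom_mem_center c) y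

namespace IsOfSymplecticType

variable (hG : IsOfSymplecticType G Z N r) (hZ : Z = scalarGroup K V)
include hG hZ

/-- The power formula contributes a commutator to the power `r.choose 2`, a multiple of `r` for odd
`r`. So `r`-th powering is multiplicative on `N` up to `r`-th powers of scalars. -/
lemma exists_mul_pow {x y : V ≃ₗ[K] V} (hx : x ∈ N) (hy : y ∈ N) (hr : 3 ≤ r) :
    ∃ d, (x * y) ^ r = x ^ r * y ^ r * scalarHom K V d ^ r := by
  obtain ⟨ζ, hζ⟩ := (mem_iff_of_eq_scalarGroup hZ).1 (hG.comm_mem y hy x hx)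
  obtain ⟨m, hm⟩ : r ∣ r.choose 2 := hG.prime.dvd_choose_self (by norm_num) hr
  refine ⟨ζ ^ m, ?_⟩
  rw [mul_pow_of_central_commutator (scalarHom_mem_center ζ) ?_, hm, map_pow, ← pow_mul,
    mul_comm r]
  rw [Subgroup.mem_center_iff.1 (scalarHom_mem_center ζ), ← hζ]
  group

variable [Module.Finite K V]

lemma mem_Z_of_commute {x : V ≃ₗ[K] V} (hx : ∀ y ∈ N, x * y = y * x) : x ∈ Z := by
  rw [hZ]
  exact mem_scalarGroup_of_commute hG.absIrred x hx

lemma exists_not_commute (hn : 1 < Module.finrank K V) : ∃ x ∈ N, ∃ y ∈ N, x * y ≠ y * x := by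
  by_contra! hcomm
  have := hG.absIrred.1
  obtain ⟨v, hv⟩ := exists_ne (0 : V)
  have htop := (eq_bot_or_eq_top_of_invariant hG.absIrred (Submodule.span K {v}) (by
    intro g hg x hx
    obtain ⟨c, rfl⟩ := (mem_iff_of_eq_scalarGroup hZ).1 (hG.mem_Z_of_commute hZ (hcomm g hg))
    exact Submodule.smul_mem _ _ hx)).resolve_left (by simpa using hv)
  have := finrank_span_singleton (K := K) hv
  rw [htop, finrank_top] at this
  omega

/-- The commutator scalar `ζ ≠ 1` of two noncommuting elements works: `x ^ r` is scalar, hence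
central, so `ζ ^ r = 1`, and `r` is prime. -/
lemma exists_isPrimitiveRoot (hn : 1 < Module.finrank K V) : ∃ ω : K, IsPrimitiveRoot ω r := by
  have := hG.absIrred.1
  have : Fact r.Prime := ⟨hG.prime⟩
  obtain ⟨x, hx, y, hy, hxy⟩ := hG.exists_not_commute hZ hn
  obtain ⟨ζ, hζ⟩ := hG.exists_commutator_scalar hZ hx hy
  have hζ' : x * y = scalarHom K V ζ * (y * x) := LinearEquiv.ext hζ
  have hne : ζ ≠ 1 := by
    rintro rfl
    exact hxy (by rw [hζ', map_one, one_mul])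
  have hpow : ∀ n : ℕ, x ^ n * y = scalarHom K V ζ ^ n * (y * x ^ n) := by
    intro n
    induction n with
    | zero => simp
    | succ n ih =>
      have hc := Subgroup.mem_center_iff.1
        (Subgroup.pow_mem _ (scalarHom_mem_center (V := V) ζ) n) x
      rw [pow_succ', mul_assoc, ih, ← mul_assoc, hc, mul_assoc, ← mul_assoc x y, hζ',
        pow_succ (scalarHom K V ζ)]
      simp only [mul_assoc]
  have hr1 : scalarHom K V ζ ^ r = 1 := by
    have := hpow r
    rwa [← commute_of_mem_scalarGroup hZ (hG.pow_mem x hx), right_eq_mul] at this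
  rw [← map_pow, ← map_one (scalarHom K V)] at hr1
  have hζr := scalarHom_injective hr1
  have hord : orderOf ζ = r := orderOf_eq_prime hζr hne
  exact ⟨ζ, IsPrimitiveRoot.coe_units_iff.2 (hord ▸ IsPrimitiveRoot.orderOf ζ)⟩

/-- If `N / Z` is a chief factor, then all elements of `N` have exponent `r` up to scalars. -/
lemma exists_pow_eq [Finite K] (hn : 1 < Module.finrank K V) (hr : 3 ≤ r)
    (hchief : IsChief G Z N) {x : V ≃ₗ[K] V} (hx : x ∈ N) :
    ∃ c, x ^ r = scalarHom K V c ^ r := by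
  have hcen : ∀ (c : Kˣ) (g : V ≃ₗ[K] V), g * scalarHom K V c = scalarHom K V c * g := fun c g =>
    Subgroup.mem_center_iff.1 (scalarHom_mem_center c) g
  let M : Subgroup (V ≃ₗ[K] V) :=
    { carrier := {x | x ∈ N ∧ ∃ c, x ^ r = scalarHom K V c ^ r}
      one_mem' := ⟨N.one_mem, 1, by simp⟩
      mul_mem' := by
        rintro x y ⟨hx, c, hc⟩ ⟨hy, d, hd⟩
        obtain ⟨m, hm⟩ := hG.exists_mul_pow hZ hx hy hr
        exact ⟨N.mul_mem hx hy, c * d * m, by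
          rw [hm, hc, hd]
          simp only [← map_pow, ← map_mul, mul_pow]⟩
      inv_mem' := by
        rintro x ⟨hx, c, hc⟩
        exact ⟨N.inv_mem hx, c⁻¹, by rw [inv_pow, hc, map_inv, inv_pow]⟩ }
  have hZM : Z ≤ M := by
    intro z hz
    obtain ⟨c, rfl⟩ := (mem_iff_of_eq_scalarGroup hZ).1 hz
    exact ⟨hG.Z_le_N hz, c, rfl⟩
  have hMnorm : (M.subgroupOf G).Normal := by
    refine ⟨?_⟩
    rintro ⟨y, hyG⟩ ⟨hy, c, hc⟩ ⟨g, hg⟩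
    refine ⟨hG.conj_mem hg hy, c, ?_⟩
    change (g * y * g⁻¹) ^ r = _
    have hc' : y ^ r = scalarHom K V c ^ r := hc
    rw [conj_pow, hc', ← map_pow, hcen, mul_assoc, mul_inv_cancel, mul_one]
  rcases hchief M hZM (fun y hy => hy.1) hMnorm with hM | hM
  -- Suppose `M = Z`. Modulo `r`-th powers the group `Kˣ` is cyclic of order dividing `r`, so for
  -- noncommuting `x`, `y` either `x` or some `x ^ m * y` lies in `M` and is central. Either way `x`
  -- and `y` commute.
  · exfalso
    obtain ⟨x, hx, y, hy, hxy⟩ := hG.exists_not_commute hZ hn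
    obtain ⟨a, ha⟩ := (mem_iff_of_eq_scalarGroup hZ).1 (hG.pow_mem x hx)
    obtain ⟨b, hb⟩ := (mem_iff_of_eq_scalarGroup hZ).1 (hG.pow_mem y hy)
    obtain ⟨γ, hγ⟩ := IsCyclic.exists_generator (α := Kˣ)
    obtain ⟨i, rfl⟩ := hγ a
    obtain ⟨j, rfl⟩ := hγ b
    simp only at ha hb
    have hcommZ : ∀ z ∈ M, ∀ w, w * z = z * w := fun z hz w =>
      commute_of_mem_scalarGroup hZ (hM ▸ hz) w
    by_cases hri : (r : ℤ) ∣ i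
    · obtain ⟨m, rfl⟩ := hri
      refine hxy (hcommZ x ⟨hx, γ ^ m, ?_⟩ y).symm
      rw [ha, ← map_pow, ← zpow_natCast (γ ^ m), ← zpow_mul, mul_comm]
    · obtain ⟨t, s, hts⟩ := (Nat.prime_iff_prime_int.1 hG.prime).coprime_iff_not_dvd.2 hri
      -- The exponent is chosen to cancel `j` modulo `r`: from `t * r + s * i = 1` one gets `j - i *
      -- s * j = j * t * r`.
      obtain ⟨d, hd⟩ := hG.exists_mul_pow hZ (N.zpow_mem hx (-(s * j))) hy hr
      have hw : x ^ (-(s * j)) * y ∈ M := by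
        refine ⟨N.mul_mem (N.zpow_mem hx _) hy, γ ^ (j * t) * d, ?_⟩
        have hxe : (x ^ (-(s * j))) ^ r = scalarHom K V (γ ^ (i * -(s * j))) := by
          rw [← zpow_natCast, ← zpow_mul, mul_comm, zpow_mul, zpow_natCast, ha, ← map_zpow,
            ← zpow_mul]
        rw [hd, hxe, hb, ← map_mul, ← zpow_add, ← map_pow, ← map_pow, ← map_mul, mul_pow,
          ← zpow_natCast (γ ^ (j * t)), ← zpow_mul]
        congr 3
        linear_combination (-j) * hts
      have h1 := hcommZ _ hw x
      refine hxy ?_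
      have h2 : x * x ^ (-(s * j)) = x ^ (-(s * j)) * x := (Commute.refl x).zpow_right _
      rw [← mul_assoc, h2, mul_assoc, mul_assoc] at h1
      exact mul_left_cancel h1
  · exact (hM ▸ hx : x ∈ M).2

end IsOfSymplecticType

end Existence

/-! ### Construction of the monomial frame -/

section Existence

variable {K V : Type*} [Field K] [AddCommGroup V] [Module K V] [Module.Finite K V]
  {r : ℕ} {G Z N : Subgroup (V ≃ₗ[K] V)}

omit [Module.Finite K V] in
/-- Vectors that are labelled by distinct systems of weights of a commuting family are linearly
independent. -/
lemma linearIndependent_of_weights {W ι : Type*} {u : W → V} (f : ι → Module.End K V)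
    (hf : ∀ i j, Commute (f i) (f j)) (hu : ∀ w, u w ≠ 0) (χ : W → ι → K)
    (hχ : Function.Injective χ) (hfu : ∀ w i, f i (u w) = χ w i • u w) :
    LinearIndependent K u := by
  have hind := Module.End.independent_iInf_maxGenEigenspace_of_forall_mapsTo f fun i j φ =>
    Module.End.mapsTo_maxGenEigenspace_of_comm (hf j i) φ
  refine (hind.comp hχ).linearIndependent _ (fun w => ?_) hu
  rw [Function.comp_apply, Submodule.mem_iInf]
  intro i
  exact (Module.End.genEigenspace _ _).mono (show (1 : ℕ∞) ≤ ⊤ from le_top)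
    (Module.End.mem_eigenspace_iff.2 (hfu w i))

namespace IsOfSymplecticType

variable (hG : IsOfSymplecticType G Z N r) (hZ : Z = scalarGroup K V)
include hG hZ

lemma center_map_eq : (Subgroup.center N).map N.subtype = Z := by
  ext x
  constructor
  · rintro ⟨y, hy, rfl⟩
    refine hG.mem_Z_of_commute hZ fun w hw => ?_
    exact (congrArg Subtype.val (Subgroup.mem_center_iff.1 hy ⟨w, hw⟩)).symm
  · intro hx
    exact ⟨⟨x, hG.Z_le_N hx⟩, Subgroup.mem_center_iff.2 fun w =>
      Subtype.ext (commute_of_mem_scalarGroup hZ hx w), rfl⟩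

lemma mem_center_iff {x : N} : x ∈ Subgroup.center N ↔ (x : V ≃ₗ[K] V) ∈ Z := by
  rw [← hG.center_map_eq hZ]
  constructor
  · exact fun h => ⟨x, h, rfl⟩
  · rintro ⟨y, hy, hyx⟩
    rwa [← Subtype.ext hyx]

/-- There are abelian subgroups `D` and `S` that generate `N`, meet in `Z`, and such that `D` is
its own centraliser in `N`. -/
lemma exists_lagrangian_pair [Finite K] (hn : 1 < Module.finrank K V) :
    ∃ D S : Subgroup (V ≃ₗ[K] V), Z ≤ D ∧ Z ≤ S ∧ D ≤ N ∧ S ≤ N ∧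
      D ≤ Subgroup.centralizer (D : Set (V ≃ₗ[K] V)) ∧
      S ≤ Subgroup.centralizer (S : Set (V ≃ₗ[K] V)) ∧
      (∀ x ∈ N, (∀ d ∈ D, d * x = x * d) → x ∈ D) ∧ D ⊓ S = Z ∧ D ⊔ S = N := by
  have := hG.absIrred.1
  have : Finite V := Module.finite_of_finite K
  have : Finite (V ≃ₗ[K] V) := Finite.of_injective (fun g : V ≃ₗ[K] V => (g : V → V))
    DFunLike.coe_injective
  obtain ⟨ω, hω⟩ := hG.exists_isPrimitiveRoot hZ hn
  have hN : ∀ x y : N, ⁅x, y⁆ ∈ Subgroup.center N := fun x y =>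
    (hG.mem_center_iff hZ).2 (hG.comm_mem x x.2 y y.2)
  have hpow : ∀ x : N, x ^ r ∈ Subgroup.center N := fun x =>
    (hG.mem_center_iff hZ).2 (hG.pow_mem x x.2)
  let ψ : Kˣ ≃* (scalarHom K V).range := MonoidHom.ofInjective scalarHom_injective
  let ι : Subgroup.center N →* (scalarHom K V).range :=
    MonoidHom.codRestrict (N.subtype.comp (Subgroup.center N).subtype) _ fun x => by
      obtain ⟨c, hc⟩ := (mem_iff_of_eq_scalarGroup hZ).1 ((hG.mem_center_iff hZ).1 x.2)
      exact ⟨c, hc.symm⟩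
  have hι : Function.Injective ι := by
    intro x y hxy
    have h : (ι x : V ≃ₗ[K] V) = ι y := by rw [hxy]
    exact Subtype.ext (Subtype.ext h)
  obtain ⟨D, S, hZD, hZS, hDc, hSS, hDS, htop⟩ := exists_complementary_abelian hG.prime hN hpow
    (fun X hX y hy => exists_mem_centralizer_not_commute hG.prime hN hpow
      (ψ.symm.toMonoidHom.comp ι) (ψ.symm.injective.comp hι) hω X hX hy)
  have hcomm : ∀ X : Subgroup N, X ≤ Subgroup.centralizer (X : Set N) →
      X.map N.subtype ≤ Subgroup.centralizer (X.map N.subtype : Set (V ≃ₗ[K] V)) := by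
    rintro X hX _ ⟨x, hx, rfl⟩
    rw [Subgroup.mem_centralizer_iff]
    rintro _ ⟨y, hy, rfl⟩
    exact congrArg Subtype.val (Subgroup.mem_centralizer_iff.1 (hX hx) y hy)
  rw [← hG.center_map_eq hZ]
  refine ⟨D.map N.subtype, S.map N.subtype, Subgroup.map_mono hZD, Subgroup.map_mono hZS,
    Subgroup.map_subtype_le D, Subgroup.map_subtype_le S, hcomm D hDc.ge, hcomm S hSS, ?_, ?_, ?_⟩
  · intro x hx hxD
    refine ⟨⟨x, hx⟩, ?_, rfl⟩
    rw [← hDc]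
    exact Subgroup.mem_centralizer_iff.2 fun d hd => Subtype.ext (hxD d ⟨d, hd, rfl⟩)
  · rw [← Subgroup.map_inf _ _ _ N.subtype_injective, hDS]
  · rw [← Subgroup.map_sup, htop, ← MonoidHom.range_eq_map, Subgroup.range_subtype]

/-- If `N / Z` is a chief factor, then `N` has a monomial frame. -/
theorem exists_isMonomialFrame [Finite K] (hn : 1 < Module.finrank K V) (hr : 3 ≤ r)
    (hchief : IsChief G Z N) :
    ∃ (k : ℕ) (D D₁ S : Subgroup (V ≃ₗ[K] V)) (u : Module.Basis (Fin k → ZMod r) K V),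
      IsMonomialFrame Z N D D₁ S u := by
  have := hG.absIrred.1
  have : Fact r.Prime := ⟨hG.prime⟩
  have : Finite V := Module.finite_of_finite K
  have : Finite (V ≃ₗ[K] V) := Finite.of_injective (fun g : V ≃ₗ[K] V => (g : V → V))
    DFunLike.coe_injective
  obtain ⟨ω, hω⟩ := hG.exists_isPrimitiveRoot hZ hn
  obtain ⟨D, S', hZD, hZS', hDN, hSN', hDD, hSS', hDmax, hDS', hsup'⟩ :=
    hG.exists_lagrangian_pair hZ hn
  have hroot : ∀ x ∈ N, ∃ c, x ^ r = scalarHom K V c ^ r := fun x hx =>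
    hG.exists_pow_eq hZ hn hr hchief hx
  obtain ⟨u₀, hu₀, hDu⟩ := exists_common_eigenvector hG.prime.pos hω hDD
    fun x hx => hroot x (hDN hx)
  obtain ⟨v₀, hv₀, hSv⟩ := exists_common_eigenvector hG.prime.pos hω hSS'
    fun x hx => hroot x (hSN' hx)
  set D₁ := D ⊓ MulAction.stabilizer (V ≃ₗ[K] V) u₀ with hD₁
  -- Fixing an eigenvector of `S'` selects a complement to the scalars in `S'`. It is elementary
  -- abelian, since its `r`-th powers are scalars fixing `v₀`.
  set S := S' ⊓ MulAction.stabilizer (V ≃ₗ[K] V) v₀ with hS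
  have hZS : Z ⊔ S = S' := by rw [hZ] at hZS' ⊢; exact sup_stabilizer_eq hZS' hSv
  have hZS_inf : Z ⊓ S = ⊥ := by rw [hZ]; exact inf_stabilizer_eq_bot hv₀ S'
  have hSN : S ≤ N := inf_le_left.trans hSN'
  have hsup : D ⊔ S = N := by
    rw [← hsup', ← hZS, ← sup_assoc, sup_eq_left.2 hZD]
  have hinf : D ⊓ S = ⊥ := by
    rw [← hZS_inf, ← hDS', inf_assoc, inf_eq_right.2 (inf_le_left : S ≤ S')]
  have hnormal : (D.subgroupOf N).Normal := by
    refine ⟨fun d hd n => ?_⟩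
    have h1 : (n * d * n⁻¹ : N).val = (n.val * d.val * n.val⁻¹ * d.val⁻¹) * d.val := by
      push_cast; group
    rw [Subgroup.mem_subgroupOf, h1]
    exact D.mul_mem (hZD (hG.comm_mem _ n.2 _ d.2)) hd
  have hprod : ∀ n ∈ N, ∃ d ∈ D, ∃ s ∈ S, n = d * s := by
    intro n hn
    have htop : D.subgroupOf N ⊔ S.subgroupOf N = ⊤ := by
      rw [← Subgroup.subgroupOf_sup hDN hSN, hsup, Subgroup.subgroupOf_self]
    have hm : (⟨n, hn⟩ : N) ∈ D.subgroupOf N ⊔ S.subgroupOf N := htop ▸ Subgroup.mem_top _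
    obtain ⟨d, hd, s, hs, hds⟩ := Subgroup.mem_sup_of_normal_left.1 hm
    exact ⟨d, hd, s, hs, congrArg Subtype.val hds.symm⟩
  have hScomm : ∀ s t : S, s * t = t * s := fun s t => Subtype.ext
    (Subgroup.mem_centralizer_iff.1 (hSS' t.2.1) s s.2.1)
  have hSpow : ∀ s : S, s ^ r = 1 := by
    intro s
    have : (s : V ≃ₗ[K] V) ^ r ∈ Z ⊓ S := ⟨hG.pow_mem _ (hSN s.2), S.pow_mem s.2 r⟩
    rw [hZS_inf, Subgroup.mem_bot] at this
    exact Subtype.ext this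
  let _ : CommGroup S := { (inferInstance : Group S) with mul_comm := hScomm }
  obtain ⟨k, ⟨φ⟩⟩ := exists_mulEquiv_of_pow_eq_one r hSpow
  let t : (Fin k → ZMod r) → V ≃ₗ[K] V := fun w => (φ (.ofAdd w) : S)
  have htS : ∀ w, t w ∈ S := fun w => (φ (.ofAdd w)).2
  have ht_add : ∀ a w, t (a + w) = t a * t w := fun a w => by
    simp only [t, ofAdd_add, map_mul, Subgroup.coe_mul]
  have ht_zero : t 0 = 1 := by simp [t]
  have ht_inj : Function.Injective t := fun a b hab =>
    Multiplicative.ofAdd.injective (φ.injective (Subtype.ext hab))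
  have ht_surj : ∀ s ∈ S, ∃ w, t w = s := fun s hs =>
    ⟨(φ.symm ⟨s, hs⟩).toAdd, by simp [t]⟩
  have hweight : ∀ w, ∀ d : D, ∃ c : Kˣ, (d : V ≃ₗ[K] V) (t w u₀) = (c : K) • t w u₀ := by
    intro w d
    obtain ⟨ζ, hζ⟩ := hG.exists_commutator_scalar hZ (hDN d.2) (hSN (htS w))
    obtain ⟨c, hc⟩ := hDu d d.2
    exact ⟨ζ * c, by rw [hζ, hc, map_smul, smul_smul, Units.val_mul]⟩
  choose χ hχ using hweight
  have hne : ∀ w, t w u₀ ≠ 0 := fun w h => hu₀ ((t w).injective (by rw [h, map_zero]))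
  -- If the weights at `v` and `w` agree, then `t (w - v)` centralises `D`, so it lies in `D ⊓ S =
  -- ⊥`. Distinct weights then give linear independence of the orbit of `u₀`.
  have hχ_inj : Function.Injective fun w (d : D) => (χ w d : K) := by
    intro v w hvw
    have hmem : t (w - v) ∈ D := by
      refine hDmax _ (hSN (htS _)) fun d hd => ?_
      obtain ⟨ζ, hζ⟩ := hG.exists_commutator_scalar hZ (hDN hd) (hSN (htS (w - v)))
      have h1 := hζ (t v u₀)
      have h2 : t (w - v) (t v u₀) = t w u₀ := by
        rw [← LinearEquiv.mul_apply, ← ht_add, sub_add_cancel]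
      have h3 : (χ v ⟨d, hd⟩ : K) = χ w ⟨d, hd⟩ := congrFun hvw ⟨d, hd⟩
      rw [h2, hχ w ⟨d, hd⟩, hχ v ⟨d, hd⟩, map_smul, h2, ← h3, smul_smul] at h1
      have h4 := smul_left_injective K (hne w) h1
      have h5 : (ζ : K) = 1 := (mul_eq_right₀ (χ v ⟨d, hd⟩).ne_zero).1 h4.symm
      ext x
      simpa [h5] using hζ x
    have h0 : t (w - v) = 1 := by
      have : t (w - v) ∈ D ⊓ S := ⟨hmem, htS _⟩
      rwa [hinf, Subgroup.mem_bot] at this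
    have := ht_inj (h0.trans ht_zero.symm)
    exact (sub_eq_zero.1 this).symm
  have hli : LinearIndependent K fun w => t w u₀ := by
    refine linearIndependent_of_weights (fun d : D => ((d : V ≃ₗ[K] V) : V →ₗ[K] V))
      (fun d d' => ?_) hne _ hχ_inj fun w d => hχ w d
    refine LinearMap.ext fun x => ?_
    exact DFunLike.congr_fun (Subgroup.mem_centralizer_iff.1 (hDD d'.2) d d.2) x
  -- `S` permutes the orbit and `D` scales its members, so the span is `N`-invariant and
  -- irreducibility applies.
  have hspan : Submodule.span K (Set.range fun w => t w u₀) = ⊤ := by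
    refine (eq_bot_or_eq_top_of_invariant hG.absIrred _ ?_).resolve_left ?_
    · intro g hg x hx
      obtain ⟨d, hd, s, hs, rfl⟩ := hprod g hg
      obtain ⟨a, rfl⟩ := ht_surj s hs
      have hle : Submodule.span K (Set.range fun w => t w u₀) ≤
          (Submodule.span K (Set.range fun w => t w u₀)).comap
            ((d * t a : V ≃ₗ[K] V) : V →ₗ[K] V) := by
        rw [Submodule.span_le]
        rintro _ ⟨w, rfl⟩
        have : (d * t a) (t w u₀) = (χ (a + w) ⟨d, hd⟩ : K) • t (a + w) u₀ := by
          rw [← hχ (a + w) ⟨d, hd⟩, ht_add]; rfl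
        simp only [Submodule.comap_coe, Set.mem_preimage, LinearEquiv.coe_coe, SetLike.mem_coe]
        rw [this]
        exact Submodule.smul_mem _ _ (Submodule.subset_span ⟨a + w, rfl⟩)
      exact hle hx
    · intro hbot
      have : t 0 u₀ ∈ Submodule.span K (Set.range fun w => t w u₀) :=
        Submodule.subset_span ⟨0, rfl⟩
      rw [hbot, Submodule.mem_bot] at this
      exact hne 0 this
  let u : Module.Basis (Fin k → ZMod r) K V := Module.Basis.mk hli hspan.ge
  have hu : ∀ w, u w = t w u₀ := fun w => Module.Basis.mk_apply hli hspan.ge w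
  refine ⟨k, D, D₁, S, u, hsup, hinf, hnormal, ?_, ?_, ?_, ?_, ?_⟩
  · rw [hZ] at hZD ⊢; exact sup_stabilizer_eq hZD hDu
  · rw [hZ]; exact inf_stabilizer_eq_bot hu₀ D
  · have hta : ∀ a w, t a (u w) = u (a + w) := fun a w => by rw [hu, hu, ht_add]; rfl
    intro s
    constructor
    · intro hs
      obtain ⟨a, rfl⟩ := ht_surj s hs
      exact ⟨a, hta a⟩
    · rintro ⟨a, ha⟩
      have : s = t a := LinearEquiv.toLinearMap_injective (u.ext fun w => by simp [ha, hta])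
      exact this ▸ htS a
  · intro d hd w
    exact ⟨χ w ⟨d, hd⟩, by rw [hu]; exact hχ w ⟨d, hd⟩⟩
  · intro d hd
    rw [hu, ht_zero]
    exact hd.2

end IsOfSymplecticType

end Existence

end SymplecticType

end

theorem theorem5p6 {K V : Type*} [Field K] [Finite K] [AddCommGroup V] [Module K V]
    [Module.Finite K V] (hn : 1 < Module.finrank K V)
    (r : ℕ) [Fact r.Prime] (hr : 3 ≤ r)
    (G Z N : Subgroup (V ≃ₗ[K] V))
    (hcop : (Nat.card G).Coprime (Nat.card V))
    (hG : SymplecticType.IsOfSymplecticType G Z N r)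
    (hZ : Z = SymplecticType.scalarGroup K V) :
    -- the decomposition of `N` and the adapted basis exist
    (SymplecticType.IsChief G Z N →
      ∃ (k : ℕ) (D D₁ S : Subgroup (V ≃ₗ[K] V)) (u : Module.Basis (Fin k → ZMod r) K V),
        SymplecticType.IsMonomialFrame Z N D D₁ S u) ∧
    -- and for every choice of them, of a basis `e` of `W`, and of a generator `α` of `Kˣ`:
    (∀ (k : ℕ) (D D₁ S : Subgroup (V ≃ₗ[K] V)) (u : Module.Basis (Fin k → ZMod r) K V),
      SymplecticType.IsMonomialFrame Z N D D₁ S u →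
      ∀ (e : Module.Basis (Fin k) (ZMod r) (Fin k → ZMod r)) (hk : 0 < k)
        (α : Kˣ), (∀ β : Kˣ, β ∈ Subgroup.zpowers α) →
        -- `k = 1`, `|W| ≠ 3`
        (k = 1 → r ^ k ≠ 3 →
          SymplecticType.IsBasePair G (u 0)
            (∑ w ∈ ({e ⟨0, hk⟩} : Finset (Fin k → ZMod r))ᶜ, u w)) ∧
        -- `k ≥ 2`, `|W| ≠ 9`: the standard partition is regular and has the required size, and
        -- every such regular partition `W = {e₁} ∪ Ω₂ ∪ Ω₃` gives a base
        (2 ≤ k → r ^ k ≠ 9 →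
          (SymplecticType.IsRegularPartition (SymplecticType.permPart G u)
              ![{e ⟨0, hk⟩}, SymplecticType.stdOmega₂ e,
                ({e ⟨0, hk⟩} ∪ SymplecticType.stdOmega₂ e)ᶜ] ∧
            4 * ((SymplecticType.stdOmega₂ e).card + 2) < r ^ k) ∧
          ∀ Ω₂ Ω₃ : Finset (Fin k → ZMod r),
            SymplecticType.IsRegularPartition (SymplecticType.permPart G u)
              ![{e ⟨0, hk⟩}, Ω₂, Ω₃] →
            4 * (Ω₂.card + 2) < r ^ k →
            SymplecticType.IsBasePair G (u 0)
              ((α : K) • u (e ⟨0, hk⟩) + ∑ w ∈ Ω₃, u w)) ∧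
        -- `|W| = 9`
        (∀ hk2 : 1 < k, r ^ k = 9 →
          SymplecticType.IsBasePair G (u 0)
            ((α : K) • u (e ⟨0, hk⟩) + (0 : K) • u (e ⟨1, hk2⟩) +
              ∑ w ∈ ({e ⟨0, hk⟩, e ⟨1, hk2⟩} : Finset (Fin k → ZMod r))ᶜ, u w)) ∧
        -- `|W| = 3`, `W = {0, w₂, w₃}`
        (r ^ k = 3 → ∀ w₂ w₃ : Fin k → ZMod r, w₂ ≠ 0 → w₃ ≠ 0 → w₂ ≠ w₃ →
          SymplecticType.IsBasePair G (u 0) ((α : K) • u w₂ + u w₃))) := by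
  refine ⟨fun hchief => hG.exists_isMonomialFrame hZ hn hr hchief, ?_⟩
  intro k D D₁ S u h e hk α hα
  refine ⟨fun hk1 h3 => h.isBasePair_rank_one hG hZ hr e hk hk1 h3, fun hk2 h9 => ⟨⟨?_, ?_⟩, ?_⟩,
    fun hk2 h9 => h.isBasePair_card_nine hn hcop hG hZ hr e hk hk2 h9 hα,
    fun h3 w₂ w₃ hw₂ hw₃ hne => h.isBasePair_card_three hn hcop hG hZ hr h3 hα hw₂ hw₃ hne⟩
  · exact h.isRegularPartition_stdOmega₂ hG hZ hr e hk
  · exact SymplecticType.card_stdOmega₂_lt e hr hk2 h9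
  · intro Ω₂ Ω₃ hreg hcard
    exact h.isBasePair_of_isRegularPartition hG hZ (e.ne_zero _) hα hreg hcard
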